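/- Multi-indices of rank $n\ge 0$ are $\sigma=(\sigma_1,\dots,\sigma_n)$ with entries in $\{-1,0,1\}$ and $\bar\sigma=\sum_i\sigma_i$; juxtaposition is concatenation. Let $\ell\ge 0$ be an integer. A spin multi-index $\sigma$ *exists* at degree $\ell$ if $|\bar\sigma|\le\ell$. The empty regularity multi-index exists; $\mathrm{ab}$ (with $\mathrm a$ a single index) exists if $\mathrm b$ exists and, in case $\ell+\bar{\mathrm b}=0$, $\mathrm a=+1$. Put $$k^{\mu}_{\ell,s}=-\mu\sqrt{\tfrac{(\ell-\mu s)(\ell+\mu s+1)}2},\qquad \xi^-_L=\sqrt{\tfrac{L}{2L+1}},\quad \xi^0_L=0,\quad \xi^+_L=\sqrt{\tfrac{L+1}{2L+1}},$$ $$D^+_L=\frac{d}{dr}-\frac{L}{r},\qquad D^-_L=\frac{d}{dr}+\frac{L+1}{r}$$ (no $D^0$ is needed, since $\xi^0=0$). With rows and columns ordered $-1,0,1$, let $$J_-=\begin{pmatrix}0&-\sqrt2&0\\0&0&\sqrt2\\0&0&0\end{pmatrix},\quad J_0=\begin{pmatrix}-1&0&0\\0&0&0\\0&0&1\end{pmatrix},\quad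 J_+=J_-^{\top},$$ and $\mathcal J^\sigma_0=0$, $\mathcal J^\sigma_{n+1}=\mathcal J^\sigma_n\otimes I_1+I_n\otimes J_\sigma^{\top}$, where $I_n$ is the $3^n\times3^n$ identity. Define $\mathcal Q_\ell(\{\},\{\})=1$ and, for $\sigma\tau$ and $\mathrm{ab}$ existing at degree $\ell$ ($\sigma,\mathrm a$ single indices, $\tau,\mathrm b$ of rank $n$) and $L=\ell+\bar{\mathrm b}$, $$\mathcal Q_\ell(\sigma\tau,\mathrm{ab})=\begin{cases}\dfrac{L\,\delta_{\sigma,0}\,\mathcal Q_\ell(\tau,\mathrm b)-\mathcal R_\ell(\sigma\tau,\mathrm b)}{\sqrt{L(2L+1)}}&\mathrm a=-1\\[2mm]\dfrac{\sigma\,\mathcal R_\ell(\sigma\tau,\mathrm b)}{\sqrt{L(L+1)}}&\mathrm a=0\\[2mm]\dfrac{(L+1)\,\delta_{\sigma,0}\,\mathcal Q_\ell(\tau,\mathrm b)+\mathcal R_\ell(\sigma\tau,\mathrm b)}{\sqrt{(L+1)(2L+1)}}&\mathrm a=+1\end{cases}$$ $$\mathcal R_\ell(\sigma\tau,\mathrm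 b)=-k^\sigma_{\ell,\bar\tau}\mathcal Q_\ell(\tau,\mathrm b)+\frac{\sigma}{\sqrt2}\sum_{\tau'}\mathcal J^\sigma_n(\tau,\tau')\,\mathcal Q_\ell(\tau',\mathrm b),$$ entries with a non-existing index being read as $0$. Let $Y^s_{\ell,m}(\theta,\phi)$ ($|m|,|s|\le\ell$; read as $0$ otherwise) be the spin-weighted spherical harmonics $$Y^s_{\ell,m}=N^s_{\ell,m}\sin^{|m+s|}\!\tfrac\theta2\,\cos^{|m-s|}\!\tfrac\theta2\,P^{(|m+s|,|m-s|)}_{\ell-\ell_0}(\cos\theta)\,e^{im\phi},$$ $$N^s_{\ell,m}=(-1)^{\max(m,-s)}\sqrt{\tfrac{(2\ell+1)(\ell+\ell_0)!(\ell-\ell_0)!}{2(\ell+\ell_1)!(\ell-\ell_1)!}},\quad \ell_0=\max(|m|,|s|),\ \ell_1=\min(|m|,|s|),$$ with $P^{(\alpha,\beta)}_k$ the Jacobi polynomials. Let $e_0=e_r$, $e_\pm=(e_\theta\mp i e_\phi)/\sqrt2$, $e(\sigma)=e_{\sigma_1}\cdots e_{\sigma_n}$ (tensor product), and $\nabla T=\sum_i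 e_i\,\partial_iT$ in Cartesian coordinates, the new index first. Let $\mathrm{Reg}(j)$, $j\in\mathbb Z$, be the functions $f$ with $f(r)=r^jF(r^2)$ for all sufficiently small $r>0$, for some $F$ analytic at $0$. Then for every rank $n\ge0$: 1. For every $\ell$, the step of the recursion from rank $n$ to rank $n+1$ defines real numbers: for existing $\sigma\tau$ and $\mathrm{ab}$ the radicand of $k^\sigma_{\ell,\bar\tau}$ is $\ge0$ and the radicand in the denominator is $>0$. If $n\le\ell$, all rank-$n$ multi-indices exist. 2. For every $\ell$, $\sum_{\mathrm a}\mathcal Q_\ell(\sigma,\mathrm a)\mathcal Q_\ell(\sigma',\mathrm a)=\delta(\sigma,\sigma')$ for all existing rank-$n$ spin multi-indices $\sigma,\sigma'$, and $\sum_\sigma\mathcal Q_\ell(\sigma,\mathrm a)\mathcal Q_\ell(\sigma,\mathrm a')=\delta(\mathrm a,\mathrm a')$ for all existing rank-$n$ regularity multi-indices $\mathrm a,\mathrm a'$. 3. Let $T$ be a rank-$n$ complex tensor field which at the points with $0<r<1$, $0<\theta<\pi$ is the sum $$T=\sum_{\ell,m}\ \sum_{\sigma,\mathrm b}\mathcal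 Q_\ell(\sigma,\mathrm b)\,A^{\mathrm b}_{\ell,m}(r)\,Y^{\bar\sigma}_{\ell,m}(\theta,\phi)\,e(\sigma),$$ with $A^{\mathrm b}_{\ell,m}:(0,1)\to\mathbb C$ differentiable for existing $\mathrm b$. Assume that the series over $(\ell,m)$ converges unconditionally at each such point and that the series of the total derivatives of its terms with respect to $(r,\theta,\phi)$ converges (unconditionally) locally uniformly there; both are automatic for finite sums. Then at each such point $T$ is differentiable and $$\nabla T=\sum_{\ell,m}\ \sum_{\sigma\tau,\mathrm{ab}}\mathcal Q_\ell(\sigma\tau,\mathrm{ab})\,B^{\mathrm{ab}}_{\ell,m}(r)\,Y^{\overline{\sigma\tau}}_{\ell,m}(\theta,\phi)\,e(\sigma\tau),\qquad B^{\mathrm{ab}}_{\ell,m}=\xi^{\mathrm a}_{\ell+\bar{\mathrm b}}\,D^{\mathrm a}_{\ell+\bar{\mathrm b}}\,A^{\mathrm b}_{\ell,m}.$$ 4. $D^\pm_L$ maps $\mathrm{Reg}(L)$ into $\mathrm{Reg}(L\pm1)$ for every integer $L$. Consequently, if $A^{\mathrm b}\in\mathrm{Reg}(\ell+\bar{\mathrm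 b})$ for all existing rank-$n$ multi-indices $\mathrm b$, then $\xi^{\mathrm a}_{\ell+\bar{\mathrm b}}D^{\mathrm a}_{\ell+\bar{\mathrm b}}A^{\mathrm b}\in\mathrm{Reg}(\ell+\bar{\mathrm b}+\mathrm a)$ for every existing $\mathrm{ab}$. -/

import Mathlib

open Real Set Filter Topology

noncomputable section

/-! ## Multi-indices

A multi-index of rank `n` is a map `Fin n → SignType`, where `SignType = {-1, 0, 1}`.  It is used
both for spin indices (Greek letters) and for regularity indices (Roman letters). -/

/-- The sum of the entries of a multi-index. -/
def wt {n : ℕ} (σ : Fin n → SignType) : ℤ := ∑ i, ((σ i : SignType) : ℤ)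

/-- At degree `ℓ` only the spin multi-indices with `|σ̄| ≤ ℓ` exist, since there is no spin-weighted
harmonic of degree `ℓ` and spin weight `s` when `|s| > ℓ`. -/
def SpinExists (ℓ : ℕ) {n : ℕ} (σ : Fin n → SignType) : Prop := |wt σ| ≤ (ℓ : ℤ)

/-- The regularity multi-indices that exist at degree `ℓ`: the empty one, and `a b` (with a single
first entry `a`) if `b` exists and, in case `ℓ + b̄ = 0`, moreover `a = +1`. -/
def RegExists (ℓ : ℕ) : (n : ℕ) → (Fin n → SignType) → Prop
  | 0, _ => True
  | n + 1, a => RegExists ℓ n (Fin.tail a) ∧ ((ℓ : ℤ) + wt (Fin.tail a) = 0 → a 0 = 1)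

/-! ## The coefficients `Q` -/

/-- The wavenumbers `k^μ_{ℓ,s} = -μ √((ℓ - μ s)(ℓ + μ s + 1) / 2)`. -/
def kNum (ℓ : ℕ) (μ : SignType) (s : ℤ) : ℝ :=
  -(((μ : SignType) : ℤ) : ℝ) *
    √(((((ℓ : ℤ) - (μ : ℤ) * s) * ((ℓ : ℤ) + (μ : ℤ) * s + 1) : ℤ) : ℝ) / 2)

/-- The `3 × 3` matrices `J_-`, `J_0`, `J_+`, with rows and columns indexed by `-1, 0, 1`. -/
def Jmat : SignType → Matrix SignType SignType ℝ
  | .neg => Matrix.of fun i j => match i, j with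
    | .neg, .zero => -√2
    | .zero, .pos => √2
    | _, _ => 0
  | .zero => Matrix.of fun i j => match i, j with
    | .neg, .neg => -1
    | .pos, .pos => 1
    | _, _ => 0
  | .pos => Matrix.of fun i j => match i, j with
    | .zero, .neg => -√2
    | .pos, .zero => √2
    | _, _ => 0

/-- The Kronecker sum of `n` copies of the transpose of `J_σ`, with rows and columns indexed by
multi-indices:  `𝒥_0 = 0`, `𝒥_{n+1} = 𝒥_n ⊗ I + I ⊗ J_σᵀ`, the last factor of the Kronecker product
acting on the last entry of a multi-index. -/
def Jten (σ : SignType) : (n : ℕ) → Matrix (Fin n → SignType) (Fin n → SignType) ℝ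
  | 0 => 0
  | n + 1 => Matrix.of fun τ τ' =>
      Jten σ n (Fin.init τ) (Fin.init τ') *
          (1 : Matrix SignType SignType ℝ) (τ (Fin.last n)) (τ' (Fin.last n)) +
        (1 : Matrix (Fin n → SignType) (Fin n → SignType) ℝ) (Fin.init τ) (Fin.init τ') *
          (Jmat σ).transpose (τ (Fin.last n)) (τ' (Fin.last n))

/-- `R_ℓ(σ τ, b) = -k^σ_{ℓ,τ̄} Q_ℓ(τ, b) + (σ / √2) ∑_{τ'} 𝒥^σ(τ, τ') Q_ℓ(τ', b)`, where `q` stands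
for `Q_ℓ` in rank `n`. -/
def Rcoef (ℓ : ℕ) {n : ℕ} (q : (Fin n → SignType) → (Fin n → SignType) → ℝ)
    (σ : SignType) (τ b : Fin n → SignType) : ℝ :=
  -kNum ℓ σ (wt τ) * q τ b + (((σ : SignType) : ℤ) : ℝ) / √2 * ∑ τ', Jten σ n τ τ' * q τ' b

/-- The radicand in the denominator of the recursion for `Q`, with `L = ℓ + b̄`. -/
def qRadicand (a : SignType) (L : ℤ) : ℤ :=
  match a with
  | .neg => L * (2 * L + 1)
  | .zero => L * (L + 1)
  | .pos => (L + 1) * (2 * L + 1)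

/-- The numerator in the recursion for `Q`, with `L = ℓ + b̄`, `q = Q_ℓ(τ, b)`, `R = R_ℓ(σ τ, b)`. -/
def qNumerator (a σ : SignType) (L : ℤ) (q R : ℝ) : ℝ :=
  match a with
  | .neg => (L : ℝ) * (if σ = 0 then 1 else 0) * q - R
  | .zero => (((σ : SignType) : ℤ) : ℝ) * R
  | .pos => ((L : ℝ) + 1) * (if σ = 0 then 1 else 0) * q + R

open Classical in
/-- The coefficients `Q_ℓ(σ, a)` in rank `n`, by the tensor-index recursion.  Entries whose row or
column does not exist at degree `ℓ` are read as zero; for `n ≤ ℓ` all rows and columns exist. -/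
def Qcoef (ℓ : ℕ) : (n : ℕ) → (Fin n → SignType) → (Fin n → SignType) → ℝ
  | 0, _, _ => 1
  | n + 1, σ, a =>
      if SpinExists ℓ σ ∧ RegExists ℓ (n + 1) a then
        qNumerator (a 0) (σ 0) (ℓ + wt (Fin.tail a))
            (Qcoef ℓ n (Fin.tail σ) (Fin.tail a))
            (Rcoef ℓ (Qcoef ℓ n) (σ 0) (Fin.tail σ) (Fin.tail a)) /
          √(qRadicand (a 0) (ℓ + wt (Fin.tail a)) : ℝ)
      else 0

/-! ## Spin-weighted spherical harmonics -/

/-- The Jacobi polynomial `P_n^{(a,b)}(z)` with natural-number parameters. -/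
def jacobiP (n a b : ℕ) (z : ℝ) : ℝ :=
  ∑ j ∈ Finset.range (n + 1), ((n + a).choose (n - j) : ℝ) * ((n + b).choose j : ℝ) *
    ((z - 1) / 2) ^ j * ((z + 1) / 2) ^ (n - j)

/-- The normalisation `N^s_{ℓ,m}`, for `|m|, |s| ≤ ℓ`. -/
def Ynorm (ℓ : ℕ) (m s : ℤ) : ℝ :=
  (-1 : ℝ) ^ (max m (-s)) *
    √(((2 * ℓ + 1 : ℕ) * (ℓ + max m.natAbs s.natAbs).factorial *
          (ℓ - max m.natAbs s.natAbs).factorial : ℝ) /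
        (2 * (ℓ + min m.natAbs s.natAbs).factorial * (ℓ - min m.natAbs s.natAbs).factorial : ℝ))

/-- The spin-weighted spherical harmonic `Y^s_{ℓ,m}(θ, φ)`, which exists for `|m|, |s| ≤ ℓ` and is
read as zero otherwise. -/
def spinY (ℓ : ℕ) (m s : ℤ) (θ φ : ℝ) : ℂ :=
  if max m.natAbs s.natAbs ≤ ℓ then
    ((Ynorm ℓ m s * sin (θ / 2) ^ (m + s).natAbs * cos (θ / 2) ^ (m - s).natAbs *
        jacobiP (ℓ - max m.natAbs s.natAbs) (m + s).natAbs (m - s).natAbs (cos θ) : ℝ) : ℂ) *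
      Complex.exp (Complex.I * m * φ)
  else 0

/-! ## Spherical coordinates, spin basis, tensor fields and their gradient

A complex tensor field of rank `n` on `ℝ³` is given by its Cartesian components, that is, as a map
`EuclideanSpace ℝ (Fin 3) → (Fin n → Fin 3) → ℂ`. -/

/-- The unit vector `e_r` at the angles `(θ, φ)`, in Cartesian components. -/
def eR (θ φ : ℝ) : Fin 3 → ℝ := ![sin θ * cos φ, sin θ * sin φ, cos θ]

/-- The unit vector `e_θ`, in Cartesian components. -/
def eTheta (θ φ : ℝ) : Fin 3 → ℝ := ![cos θ * cos φ, cos θ * sin φ, -sin θ]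

/-- The unit vector `e_φ`, in Cartesian components. -/
def ePhi (φ : ℝ) : Fin 3 → ℝ := ![-sin φ, cos φ, 0]

/-- The point with spherical coordinates `p = (r, θ, φ)`. -/
def sphPoint (p : ℝ × ℝ × ℝ) : EuclideanSpace ℝ (Fin 3) :=
  WithLp.toLp 2 (p.1 • eR p.2.1 p.2.2)

/-- The spherical coordinates of the points of the open unit ball off the polar axis. -/
def sphDomain : Set (ℝ × ℝ × ℝ) := Ioo 0 1 ×ˢ Ioo 0 π ×ˢ univ

/-- The spin basis `e_0 = e_r`, `e_± = (e_θ ∓ i e_φ) / √2`, in Cartesian components. -/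
def spinBasis (σ : SignType) (θ φ : ℝ) (i : Fin 3) : ℂ :=
  match σ with
  | .neg => ((eTheta θ φ i : ℂ) + Complex.I * (ePhi φ i : ℂ)) / (√2 : ℝ)
  | .zero => (eR θ φ i : ℂ)
  | .pos => ((eTheta θ φ i : ℂ) - Complex.I * (ePhi φ i : ℂ)) / (√2 : ℝ)

/-- The basis tensor `e(σ) = e_{σ₁} ⋯ e_{σₙ}`, in Cartesian components. -/
def spinTensor {n : ℕ} (σ : Fin n → SignType) (θ φ : ℝ) (I : Fin n → Fin 3) : ℂ :=
  ∏ j, spinBasis (σ j) θ φ (I j)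

/-- The `(ℓ, m)` term `∑_{σ,a} Q_ℓ(σ, a) A^a(r) Y^{σ̄}_{ℓ,m}(θ, φ) e(σ)` of a rank-`n` tensor field,
as a function of the coordinates `p = (r, θ, φ)`, with values in Cartesian components. -/
def tensorTerm (ℓ : ℕ) (m : ℤ) {n : ℕ} (A : (Fin n → SignType) → ℝ → ℂ) (p : ℝ × ℝ × ℝ) :
    (Fin n → Fin 3) → ℂ := fun I =>
  ∑ σ : Fin n → SignType, ∑ a : Fin n → SignType,
    (Qcoef ℓ n σ a : ℂ) * A a p.1 * spinY ℓ m (wt σ) p.2.1 p.2.2 * spinTensor σ p.2.1 p.2.2 I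

/-- The gradient `∇T = ∑_i e_i ∂_i T`, the first index being the one of the derivative. -/
def tensorGrad {n : ℕ} (T : EuclideanSpace ℝ (Fin 3) → (Fin n → Fin 3) → ℂ)
    (x : EuclideanSpace ℝ (Fin 3)) : (Fin (n + 1) → Fin 3) → ℂ := fun K =>
  fderiv ℝ T x (EuclideanSpace.single (K 0) 1) (Fin.tail K)

/-! ## Radial operators and regularity classes -/

/-- `ξ^-_L = √(L / (2L+1))`, `ξ^0_L = 0`, `ξ^+_L = √((L+1) / (2L+1))`. -/
def xi (a : SignType) (L : ℤ) : ℝ :=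
  match a with
  | .neg => √((L : ℝ) / (2 * L + 1))
  | .zero => 0
  | .pos => √(((L : ℝ) + 1) / (2 * L + 1))

/-- `D^-_L = d/dr + (L+1)/r` and `D^+_L = d/dr - L/r`.  (There is no operator `D^0`; it would only
occur with the factor `ξ^0 = 0`, and is read as zero.) -/
def radialD (a : SignType) (L : ℤ) (f : ℝ → ℂ) (r : ℝ) : ℂ :=
  match a with
  | .neg => deriv f r + ((L : ℂ) + 1) / r * f r
  | .zero => 0
  | .pos => deriv f r - (L : ℂ) / r * f r

/-- The coefficients `B^{ab} = ξ^a_{ℓ+b̄} D^a_{ℓ+b̄} A^b`, with `a` a single index. -/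
def gradCoeff (ℓ : ℕ) {n : ℕ} (A : (Fin n → SignType) → ℝ → ℂ) (ab : Fin (n + 1) → SignType)
    (r : ℝ) : ℂ :=
  (xi (ab 0) (ℓ + wt (Fin.tail ab)) : ℂ) *
    radialD (ab 0) (ℓ + wt (Fin.tail ab)) (A (Fin.tail ab)) r

/-- The regularity class `Reg(j)`: functions equal to `r^j F(r²)` for all small `r > 0`, with `F`
analytic at `0`. -/
def Reg (j : ℤ) : Set (ℝ → ℂ) :=
  {f | ∃ F : ℝ → ℂ, AnalyticAt ℝ F 0 ∧ ∀ᶠ r in 𝓝[>] (0 : ℝ), f r = (r : ℂ) ^ j * F (r ^ 2)}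

end

/-! ## Sums over multi-indices -/

/-! Fix `ℓ`, `m` and read a column `Q_ℓ(·, b)` as the angular tensor field `∑_τ Q_ℓ(τ, b) Y^{τ̄}
e(τ)`. Its derivative along the sphere in the spin direction `σ = ±1` is again such a field, with
coefficients `-ladder σ`: the wavenumber comes from the harmonic, the Kronecker sum from the turning
of the frame, and the two `cot θ` terms cancel because the spin weight of the harmonic is the weight
of `e(τ)` (`hasSpinDeriv_angularField`). Since `R_ℓ` is `ladder`, the recursion builds its new
columns from the radial part `e_0 ⊗ f` and the tangential gradient of an old column `f`.

The two ladder operators are negative adjoints of each other, and their commutator on functions of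
weight `w` is `w` (`sum_mul_ladder_neg_one`, `ladder_neg_one_one_eq`). Hence, by induction on the
rank, each existing column is an eigenvector of `ladder (-1) ∘ ladder 1`, half the spherical
Laplacian of the Cartesian components, with eigenvalue `-L(L+1)/2`, `L = ℓ + b̄`
(`Qcoef_ladder_ladder`). So both tangential parts of a unit column have squared norm `L(L+1)/2`, and
the radicands of the recursion are exactly the resulting normalisations; this gives orthonormal
columns. Rows follow because there are as many existing spin indices as regularity indices
(`sum_spinExists_eq_sum_regExists`), so the matrix is square.

For the gradient, `∇ = e_r ∂_r + r⁻¹ (tangential part)` turns `A^b` into `δ_{σ0} (A^b)' Q - (A^b /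
r) R`, and summing `Q ξ^a D^a A^b` over `a` recovers this expression (`sum_Qcoef_cons_mul_radialD`).
The derivative formula for the harmonics comes from their realisation as coefficients of a rotated
binary form (`rotPoly`). Locally uniform convergence allows termwise differentiation, and spherical
coordinates are a local diffeomorphism off the axis. The regularity statement is the computation of
`D^± (r^L F(r²))`. -/

theorem sum_signType {M : Type*} [AddCommMonoid M] (f : SignType → M) :
    ∑ c, f c = f (-1) + f 0 + f 1 := by
  rw [show (Finset.univ : Finset SignType) = {-1, 0, 1} by decide]
  rw [Finset.sum_insert (by decide), Finset.sum_insert (by decide), Finset.sum_singleton, add_assoc]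

theorem sum_multiIndex_cons {M α : Type*} [Fintype α] [AddCommMonoid M] {n : ℕ}
    (f : (Fin (n + 1) → α) → M) :
    ∑ σ, f σ = ∑ c, ∑ τ : Fin n → α, f (Fin.cons c τ) := by
  rw [← Fintype.sum_prod_type']
  exact (Fintype.sum_equiv (Fin.consEquiv fun _ => α) _ _ fun _ => rfl).symm

theorem wt_cons {n : ℕ} (c : SignType) (τ : Fin n → SignType) :
    wt (Fin.cons c τ : Fin (n + 1) → SignType) = (c : ℤ) + wt τ := by
  simp [wt, Fin.sum_univ_succ]

theorem wt_eq_add_tail {n : ℕ} (σ : Fin (n + 1) → SignType) :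
    wt σ = (σ 0 : ℤ) + wt (Fin.tail σ) := by
  simp [wt, Fin.sum_univ_succ, Fin.tail]

theorem multiIndex_one_cons {n : ℕ} (c c' : SignType) (τ τ' : Fin n → SignType) :
    (1 : Matrix (Fin (n + 1) → SignType) (Fin (n + 1) → SignType) ℝ) (Fin.cons c τ)
        (Fin.cons c' τ') =
      (1 : Matrix SignType SignType ℝ) c c' *
        (1 : Matrix (Fin n → SignType) (Fin n → SignType) ℝ) τ τ' := by
  simp only [Matrix.one_apply, Fin.cons_inj]
  split_ifs <;> simp_all

/-! ## The Kronecker sums -/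

theorem Jten_succ (σ : SignType) (n : ℕ) (τ τ' : Fin (n + 1) → SignType) :
    Jten σ (n + 1) τ τ' =
      Jten σ n (Fin.init τ) (Fin.init τ') *
          (1 : Matrix SignType SignType ℝ) (τ (Fin.last n)) (τ' (Fin.last n)) +
        (1 : Matrix (Fin n → SignType) (Fin n → SignType) ℝ) (Fin.init τ) (Fin.init τ') *
          Jmat σ (τ' (Fin.last n)) (τ (Fin.last n)) := rfl

/-- Associativity of the Kronecker sum: its definition peels off the last entry, whereas the
recursion for `Q` and all inductions on the rank peel off the first. -/
theorem Jten_cons (σ : SignType) : ∀ (n : ℕ) (c c' : SignType) (τ τ' : Fin n → SignType),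
    Jten σ (n + 1) (Fin.cons c τ) (Fin.cons c' τ') =
      Jmat σ c' c * (1 : Matrix (Fin n → SignType) (Fin n → SignType) ℝ) τ τ' +
        (1 : Matrix SignType SignType ℝ) c c' * Jten σ n τ τ'
  | 0, c, c', τ, τ' => by
    have h : ∀ (x : SignType), (Fin.cons x ![] : Fin 1 → SignType) (Fin.last 0) = x := fun _ => rfl
    obtain rfl : τ = ![] := Subsingleton.elim _ _
    obtain rfl : τ' = ![] := Subsingleton.elim _ _
    rw [Jten]
    simp only [Jten, Matrix.of_apply, h, Matrix.zero_apply, zero_mul, zero_add, mul_zero, add_zero,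
      Matrix.transpose_apply]
    rw [Matrix.one_apply, if_pos (Subsingleton.elim _ _), Matrix.one_apply,
      if_pos (Subsingleton.elim _ _), one_mul, mul_one]
  | n + 1, c, c', τ, τ' => by
    have hi : ∀ (x : SignType) (ρ : Fin (n + 1) → SignType),
        Fin.init (Fin.cons x ρ : Fin (n + 2) → SignType) = Fin.cons x (Fin.init ρ) := by
      intro x ρ
      funext i
      refine Fin.cases ?_ (fun j => ?_) i
      · rfl
      · simp [Fin.init]
    have hl : ∀ (x : SignType) (ρ : Fin (n + 1) → SignType),
        (Fin.cons x ρ : Fin (n + 2) → SignType) (Fin.last (n + 1)) = ρ (Fin.last n) :=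
      fun x ρ => rfl
    have h1 : (1 : Matrix (Fin (n + 1) → SignType) (Fin (n + 1) → SignType) ℝ) τ τ' =
        (1 : Matrix (Fin n → SignType) (Fin n → SignType) ℝ) (Fin.init τ) (Fin.init τ') *
          (1 : Matrix SignType SignType ℝ) (τ (Fin.last n)) (τ' (Fin.last n)) := by
      have : τ = τ' ↔ Fin.init τ = Fin.init τ' ∧ τ (Fin.last n) = τ' (Fin.last n) := by
        constructor
        · rintro rfl; exact ⟨rfl, rfl⟩
        · rintro ⟨h, h'⟩
          rw [← Fin.snoc_init_self τ, ← Fin.snoc_init_self τ', h, h']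
      simp only [Matrix.one_apply, this]
      split_ifs <;> simp_all
    rw [Jten_succ, hi, hi, hl, hl, Jten_cons σ n, multiIndex_one_cons, h1, Jten_succ]
    ring

/-- A selection rule: a derivation of the tensor product changes a single entry, by exactly `σ`. It
allows a factor depending only on the weight to be moved through the Kronecker sum. -/
theorem Jten_eq_zero_of_wt_ne (σ : SignType) : ∀ (n : ℕ) (τ τ' : Fin n → SignType),
    wt τ' ≠ wt τ + (σ : ℤ) → Jten σ n τ τ' = 0
  | 0, _, _, _ => rfl
  | n + 1, τ, τ', h => by
    rw [← Fin.cons_self_tail τ, ← Fin.cons_self_tail τ'] at h ⊢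
    generalize Fin.tail τ = ρ at *
    generalize Fin.tail τ' = ρ' at *
    rw [Jten_cons]
    rw [wt_cons, wt_cons] at h
    have h1 : Jmat σ (τ' 0) (τ 0) *
        (1 : Matrix (Fin n → SignType) (Fin n → SignType) ℝ) ρ ρ' = 0 := by
      by_cases hρ : ρ = ρ'
      · subst hρ
        have : ((τ' 0 : SignType) : ℤ) ≠ ((τ 0 : SignType) : ℤ) + (σ : ℤ) := fun h' => h (by
          rw [h']; ring)
        have h2 : Jmat σ (τ' 0) (τ 0) = 0 := by
          generalize τ' 0 = x at *
          generalize τ 0 = y at *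
          rcases σ <;> rcases x <;> rcases y <;> simp_all [Jmat]
        rw [h2, zero_mul]
      · rw [Matrix.one_apply_ne hρ, mul_zero]
    have h2 : (1 : Matrix SignType SignType ℝ) (τ 0) (τ' 0) * Jten σ n ρ ρ' = 0 := by
      by_cases hc : τ 0 = τ' 0
      · rw [Jten_eq_zero_of_wt_ne σ n, mul_zero]
        intro h'
        exact h (by rw [h', hc]; ring)
      · rw [Matrix.one_apply_ne hc, zero_mul]
    rw [h1, h2, add_zero]

theorem Jten_neg_eq_transpose : ∀ (n : ℕ) (τ τ' : Fin n → SignType),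
    Jten (-1) n τ τ' = Jten 1 n τ' τ
  | 0, _, _ => rfl
  | n + 1, τ, τ' => by
    rw [← Fin.cons_self_tail τ, ← Fin.cons_self_tail τ', Jten_cons, Jten_cons,
      Jten_neg_eq_transpose n, Matrix.one_apply, Matrix.one_apply, Matrix.one_apply,
      Matrix.one_apply]
    have h2 : Jmat (-1) (τ' 0) (τ 0) = Jmat 1 (τ 0) (τ' 0) := by
      generalize τ' 0 = x at *
      generalize τ 0 = y at *
      rcases x <;> rcases y <;> rfl
    simp only [h2, eq_comm]

/-- The action of the Kronecker sum `Jten σ n` on functions of a multi-index. -/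
noncomputable def Jop (σ : SignType) {n : ℕ} (f : (Fin n → SignType) → ℝ)
    (τ : Fin n → SignType) : ℝ :=
  ∑ τ', Jten σ n τ τ' * f τ'

theorem Jop_cons (σ : SignType) {n : ℕ} (f : (Fin (n + 1) → SignType) → ℝ) (c : SignType)
    (τ : Fin n → SignType) :
    Jop σ f (Fin.cons c τ) =
      ∑ c', Jmat σ c' c * f (Fin.cons c' τ) + Jop σ (fun ρ => f (Fin.cons c ρ)) τ := by
  simp only [Jop, sum_multiIndex_cons, Jten_cons, add_mul, Finset.sum_add_distrib]
  congr 1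
  · refine Finset.sum_congr rfl fun c' _ => ?_
    simp [Matrix.one_apply]
  · simp [Matrix.one_apply, Finset.sum_ite_irrel]

theorem Jop_linear (σ : SignType) {n : ℕ} (x y : ℝ) (f g : (Fin n → SignType) → ℝ)
    (τ : Fin n → SignType) :
    Jop σ (fun ρ => x * f ρ + y * g ρ) τ = x * Jop σ f τ + y * Jop σ g τ := by
  simp only [Jop, Finset.mul_sum, ← Finset.sum_add_distrib]
  exact Finset.sum_congr rfl fun _ _ => by ring

theorem Jop_add (σ : SignType) {n : ℕ} (f g : (Fin n → SignType) → ℝ)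
    (τ : Fin n → SignType) :
    Jop σ (fun ρ => f ρ + g ρ) τ = Jop σ f τ + Jop σ g τ := by
  simpa using Jop_linear σ 1 1 f g τ

theorem Jop_mul (σ : SignType) {n : ℕ} (x : ℝ) (f : (Fin n → SignType) → ℝ)
    (τ : Fin n → SignType) :
    Jop σ (fun ρ => x * f ρ) τ = x * Jop σ f τ := by
  simpa using Jop_linear σ x 0 f 0 τ

theorem Jop_zero (σ : SignType) {n : ℕ} (τ : Fin n → SignType) :
    Jop σ (fun _ => 0) τ = 0 := by
  simp [Jop]

/-! ### Entries of the raising and lowering matrices, and their commutator. -/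

@[simp] theorem Jmat_pos_zero_neg : Jmat 1 0 (-1) = -√2 := rfl
@[simp] theorem Jmat_pos_pos_zero : Jmat 1 1 0 = √2 := rfl
@[simp] theorem Jmat_pos_neg (c : SignType) : Jmat 1 (-1) c = 0 := by rcases c <;> rfl
@[simp] theorem Jmat_pos_zero_zero : Jmat 1 0 0 = 0 := rfl
@[simp] theorem Jmat_pos_pos_neg : Jmat 1 1 (-1) = 0 := rfl
@[simp] theorem Jmat_pos_pos (c : SignType) : Jmat 1 c 1 = 0 := by rcases c <;> rfl
@[simp] theorem Jmat_neg_neg_zero : Jmat (-1) (-1) 0 = -√2 := rfl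
@[simp] theorem Jmat_neg_zero_pos : Jmat (-1) 0 1 = √2 := rfl
@[simp] theorem Jmat_neg_pos (c : SignType) : Jmat (-1) 1 c = 0 := by rcases c <;> rfl
@[simp] theorem Jmat_neg_zero_zero : Jmat (-1) 0 0 = 0 := rfl
@[simp] theorem Jmat_neg_neg_pos : Jmat (-1) (-1) 1 = 0 := rfl
@[simp] theorem Jmat_neg_neg (c : SignType) : Jmat (-1) c (-1) = 0 := by rcases c <;> rfl

/-- The `sl₂` relation. Derivations on different tensor factors commute, so only the commutator on a
single factor contributes, and there it is `2 c` on the entry `c`. -/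
theorem Jop_comm {n : ℕ} (f : (Fin n → SignType) → ℝ) (τ : Fin n → SignType) :
    Jop (-1) (Jop 1 f) τ - Jop 1 (Jop (-1) f) τ = 2 * (wt τ : ℝ) * f τ := by
  induction n with
  | zero => simp [Jop, Jten, wt]
  | succ n ih =>
    rw [← Fin.cons_self_tail τ]
    generalize τ 0 = c
    generalize Fin.tail τ = ρ
    have h2 : √2 * √2 = 2 := Real.mul_self_sqrt (by norm_num)
    have := ih (fun ρ => f (Fin.cons c ρ)) ρ
    simp only [Jop_cons, Jop_add, sum_signType, Jop_mul, wt_cons, Int.cast_add]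
    rcases c
    · simp [SignType.zero_eq_zero] at this ⊢
      linear_combination this
    · simp [SignType.neg_eq_neg_one] at this ⊢
      linear_combination this  - f (Fin.cons (-1) ρ) * h2
    · simp [SignType.pos_eq_one] at this ⊢
      linear_combination this + f (Fin.cons 1 ρ) * h2

/-! ## Ladder operators -/

theorem kNum_neg_one_add (ℓ : ℕ) (s : ℤ) : kNum ℓ (-1) (s + 1) = -kNum ℓ 1 s := by
  simp only [kNum]
  have : ((ℓ : ℤ) - ((-1 : SignType) : ℤ) * (s + 1)) *
      ((ℓ : ℤ) + ((-1 : SignType) : ℤ) * (s + 1) + 1)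
      = ((ℓ : ℤ) - ((1 : SignType) : ℤ) * s) * ((ℓ : ℤ) + ((1 : SignType) : ℤ) * s + 1) := by
    simp; ring
  rw [this]
  simp

theorem kNum_zero (ℓ : ℕ) (s : ℤ) : kNum ℓ 0 s = 0 := by
  simp [kNum]

/-- Within this range the radicand is nonnegative; outside it the real square root would return its
default value `0`. -/
theorem kNum_one_sq (ℓ : ℕ) (s : ℤ) (h : -(ℓ : ℤ) - 1 ≤ s) (h' : s ≤ ℓ) :
    kNum ℓ 1 s ^ 2 = ((ℓ : ℝ) - s) * (ℓ + s + 1) / 2 := by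
  have h0 : 0 ≤ ((ℓ : ℤ) - s) * ((ℓ : ℤ) + s + 1) := mul_nonneg (by omega) (by omega)
  have h1 : (0 : ℝ) ≤ ((((ℓ : ℤ) - s) * ((ℓ : ℤ) + s + 1) : ℤ) : ℝ) / 2 :=
    div_nonneg (by exact_mod_cast h0) (by norm_num)
  simp only [kNum, SignType.coe_one, one_mul]
  rw [mul_pow, Real.sq_sqrt h1]
  push_cast
  ring

theorem kNum_neg_one (ℓ : ℕ) (s : ℤ) : kNum ℓ (-1) s = -kNum ℓ 1 (s - 1) := by
  rw [← kNum_neg_one_add, sub_add_cancel]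

theorem kNum_one_self (ℓ : ℕ) : kNum ℓ 1 ℓ = 0 := by
  simp [kNum]

theorem kNum_one_neg_self_sub_one (ℓ : ℕ) : kNum ℓ 1 (-(ℓ : ℤ) - 1) = 0 := by
  have : (ℓ : ℤ) + (-(ℓ : ℤ) - 1) + 1 = 0 := by ring
  simp only [kNum, SignType.coe_one, one_mul, this, mul_zero, Int.cast_zero, zero_div,
    Real.sqrt_zero]

/-- The ladder operator of total weight `σ` acting on the functions of total weight `w`: the value
`f τ` belongs to the spin weight `wt τ + w`. -/
noncomputable def ladder (ℓ : ℕ) (σ : SignType) (w : ℤ) {n : ℕ} (f : (Fin n → SignType) → ℝ)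
    (τ : Fin n → SignType) : ℝ :=
  -kNum ℓ σ (wt τ + w) * f τ + (((σ : SignType) : ℤ) : ℝ) / √2 * Jop σ f τ

theorem Rcoef_eq_ladder (ℓ : ℕ) {n : ℕ} (q : (Fin n → SignType) → (Fin n → SignType) → ℝ)
    (σ : SignType) (τ b : Fin n → SignType) :
    Rcoef ℓ q σ τ b = ladder ℓ σ 0 (fun ρ => q ρ b) τ := by
  simp [Rcoef, ladder, Jop]

theorem ladder_zero_left (ℓ : ℕ) (w : ℤ) {n : ℕ} (f : (Fin n → SignType) → ℝ)
    (τ : Fin n → SignType) : ladder ℓ 0 w f τ = 0 := by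
  simp [ladder, kNum_zero]

theorem ladder_mul (ℓ : ℕ) (σ : SignType) (w : ℤ) {n : ℕ} (x : ℝ) (f : (Fin n → SignType) → ℝ)
    (τ : Fin n → SignType) :
    ladder ℓ σ w (fun ρ => x * f ρ) τ = x * ladder ℓ σ w f τ := by
  simp only [ladder, Jop_mul]; ring

/-- A function of total weight `w` that vanishes where the spin weight exceeds the degree. -/
def SpinSupported (ℓ : ℕ) (w : ℤ) {n : ℕ} (f : (Fin n → SignType) → ℝ) : Prop :=
  ∀ τ, (ℓ : ℤ) < |wt τ + w| → f τ = 0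

theorem SpinSupported.Jop {ℓ : ℕ} {w : ℤ} {n : ℕ} {f : (Fin n → SignType) → ℝ}
    (hf : SpinSupported ℓ w f) (σ : SignType) : SpinSupported ℓ (w + (σ : ℤ)) (Jop σ f) := by
  intro τ h
  refine Finset.sum_eq_zero fun τ' _ => ?_
  by_cases hw : wt τ' = wt τ + (σ : ℤ)
  · rw [hf τ' (by rw [hw]; convert h using 2; ring), mul_zero]
  · rw [Jten_eq_zero_of_wt_ne σ n τ τ' hw, zero_mul]

/-- The ladder stops at the top: the only new place where the first term could survive is spin
weight `ℓ`, and `k^+_{ℓ,ℓ} = 0`. -/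
theorem SpinSupported.ladder_one {ℓ : ℕ} {w : ℤ} {n : ℕ} {f : (Fin n → SignType) → ℝ}
    (hf : SpinSupported ℓ w f) : SpinSupported ℓ (w + 1) (ladder ℓ 1 w f) := by
  intro τ h
  have hJ := hf.Jop 1 τ (by simpa using h)
  rw [ladder, hJ, mul_zero, add_zero]
  by_cases h1 : (ℓ : ℤ) < |wt τ + w|
  · rw [hf τ h1, mul_zero]
  · have : wt τ + w = ℓ := by
      rw [lt_abs] at h h1; omega
    rw [this, kNum_one_self, neg_zero, zero_mul]

theorem SpinSupported.ladder_neg_one {ℓ : ℕ} {w : ℤ} {n : ℕ} {f : (Fin n → SignType) → ℝ}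
    (hf : SpinSupported ℓ w f) : SpinSupported ℓ (w - 1) (ladder ℓ (-1) w f) := by
  intro τ h
  have hJ := hf.Jop (-1) τ (by simpa [sub_eq_add_neg] using h)
  rw [ladder, hJ, mul_zero, add_zero]
  by_cases h1 : (ℓ : ℤ) < |wt τ + w|
  · rw [hf τ h1, mul_zero]
  · have : wt τ + w - 1 = -ℓ - 1 := by
      rw [lt_abs] at h h1; omega
    rw [kNum_neg_one, this, kNum_one_neg_self_sub_one, neg_zero, neg_zero, zero_mul]

/-- The wavenumbers contribute `τ̄ + w` to the commutator, the Kronecker sums contribute `-τ̄`, and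
the mixed terms cancel by the selection rule. Thus on the total weight `w = 0` the two orders agree.
-/
theorem ladder_neg_one_one_eq (ℓ : ℕ) (w : ℤ) {n : ℕ} {f : (Fin n → SignType) → ℝ}
    (hf : SpinSupported ℓ w f) (τ : Fin n → SignType) :
    ladder ℓ (-1) (w + 1) (ladder ℓ 1 w f) τ =
      ladder ℓ 1 (w - 1) (ladder ℓ (-1) w f) τ + w * f τ := by
  have hcross : ∀ (σ : SignType) (κ : ℤ → ℝ) (f : (Fin n → SignType) → ℝ),
      Jop σ (fun ρ => κ (wt ρ) * f ρ) τ = κ (wt τ + (σ : ℤ)) * Jop σ f τ := by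
    intro σ κ f
    rw [Jop, Jop, Finset.mul_sum]
    refine Finset.sum_congr rfl fun τ' _ => ?_
    by_cases hw : wt τ' = wt τ + (σ : ℤ)
    · rw [hw]; ring
    · rw [Jten_eq_zero_of_wt_ne σ n τ τ' hw]; ring
  have hJ := Jop_comm f τ
  have hs : (1 / √2) ^ 2 = 1 / 2 := by
    rw [div_pow, Real.sq_sqrt (by norm_num)]; norm_num
  have hk : kNum ℓ (-1) (wt τ + (w + 1)) * kNum ℓ 1 (wt τ + w) * f τ
      = kNum ℓ 1 (wt τ + (w - 1)) * kNum ℓ (-1) (wt τ + w) * f τ + (wt τ + w) * f τ := by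
    -- The squares of the wavenumbers are only known for `|τ̄ + w| ≤ ℓ`; elsewhere `f τ = 0`.
    by_cases h1 : (ℓ : ℤ) < |wt τ + w|
    · rw [hf τ h1]; ring
    · rw [kNum_neg_one, kNum_neg_one]
      have h2 := abs_le.mp (not_lt.mp h1)
      have e1 := kNum_one_sq ℓ (wt τ + w) (by omega) (by omega)
      have e2 := kNum_one_sq ℓ (wt τ + w - 1) (by omega) (by omega)
      rw [show wt τ + (w + 1) - 1 = wt τ + w by ring, show wt τ + (w - 1) = wt τ + w - 1 by ring]
      push_cast at e1 e2 ⊢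
      linear_combination -f τ * e1 + f τ * e2
  have e1 : Jop (-1) (ladder ℓ 1 w f) τ =
      -kNum ℓ 1 (wt τ + (w - 1)) * Jop (-1) f τ + 1 / √2 * Jop (-1) (Jop 1 f) τ := by
    have := hcross (-1) (fun s => -kNum ℓ 1 (s + w)) f
    rw [show ladder ℓ 1 w f = fun ρ => -kNum ℓ 1 (wt ρ + w) * f ρ + 1 / √2 * Jop 1 f ρ by
      funext ρ; simp [ladder], Jop_add, this, Jop_mul]
    congr 4
    simp; ring_nf
  have e2 : Jop 1 (ladder ℓ (-1) w f) τ =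
      -kNum ℓ (-1) (wt τ + (w + 1)) * Jop 1 f τ + -1 / √2 * Jop 1 (Jop (-1) f) τ := by
    have := hcross 1 (fun s => -kNum ℓ (-1) (s + w)) f
    rw [show ladder ℓ (-1) w f = fun ρ => -kNum ℓ (-1) (wt ρ + w) * f ρ + -1 / √2 * Jop (-1) f ρ by
      funext ρ; simp [ladder], Jop_add, this, Jop_mul]
    congr 4
    simp; ring_nf
  rw [ladder, e1, ladder.eq_1 ℓ 1 (w - 1), e2, ladder, ladder]
  simp only [SignType.coe_neg_one, SignType.coe_one, Int.cast_neg, Int.cast_one]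
  linear_combination hk - (1 / √2) ^ 2 * hJ - 2 * wt τ * f τ * hs

/-- Integration by parts: `𝒥^-` is the transpose of `𝒥^+`, and `k^-_{s+1} = -k^+_s`. -/
theorem sum_mul_ladder_neg_one (ℓ : ℕ) (w : ℤ) {n : ℕ} (f g : (Fin n → SignType) → ℝ) :
    ∑ τ, f τ * ladder ℓ (-1) (w + 1) g τ = -∑ τ, ladder ℓ 1 w f τ * g τ := by
  have hJ : ∑ τ, f τ * Jop (-1) g τ = ∑ τ, Jop 1 f τ * g τ := by
    simp only [Jop, Finset.mul_sum, Finset.sum_mul]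
    rw [Finset.sum_comm]
    refine Finset.sum_congr rfl fun τ _ => Finset.sum_congr rfl fun τ' _ => ?_
    rw [Jten_neg_eq_transpose]; ring
  have h1 : ∀ τ, f τ * ladder ℓ (-1) (w + 1) g τ =
      kNum ℓ 1 (wt τ + w) * f τ * g τ - 1 / √2 * (f τ * Jop (-1) g τ) := by
    intro τ
    rw [ladder, ← add_assoc, kNum_neg_one_add]
    simp
    ring
  have h2 : ∀ τ, ladder ℓ 1 w f τ * g τ =
      -(kNum ℓ 1 (wt τ + w) * f τ * g τ) + 1 / √2 * (Jop 1 f τ * g τ) := by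
    intro τ
    rw [ladder]
    simp
    ring
  simp only [h1, h2, Finset.sum_sub_distrib, Finset.sum_add_distrib, ← Finset.mul_sum, hJ,
    Finset.sum_neg_distrib]
  ring

/-- With the first entry fixed at `c`, the remaining function has total weight `w + c`; this is why
`ladder` carries the parameter `w`. -/
theorem ladder_cons (ℓ : ℕ) (σ : SignType) (w : ℤ) {n : ℕ} (f : (Fin (n + 1) → SignType) → ℝ)
    (c : SignType) (τ : Fin n → SignType) :
    ladder ℓ σ w f (Fin.cons c τ) =
      ladder ℓ σ (w + (c : ℤ)) (fun ρ => f (Fin.cons c ρ)) τ +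
        (((σ : SignType) : ℤ) : ℝ) / √2 * ∑ c', Jmat σ c' c * f (Fin.cons c' τ) := by
  rw [ladder, ladder, Jop_cons, wt_cons, show (c : ℤ) + wt τ + w = wt τ + (w + (c : ℤ)) by ring]
  ring

/-! ## Existence of multi-indices -/

theorem SignType.abs_intCast_le_one (c : SignType) : |(c : ℤ)| ≤ 1 := by
  rcases c <;> decide

theorem abs_wt_le : ∀ {n : ℕ} (σ : Fin n → SignType), |wt σ| ≤ n
  | 0, σ => by simp [wt]
  | n + 1, σ => by
    rw [wt_eq_add_tail]
    have h1 := SignType.abs_intCast_le_one (σ 0)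
    have h2 := abs_wt_le (Fin.tail σ)
    push_cast
    linarith [abs_add_le ((σ 0 : SignType) : ℤ) (wt (Fin.tail σ))]

theorem RegExists.nonneg {ℓ : ℕ} : ∀ {n : ℕ} {b : Fin n → SignType}, RegExists ℓ n b →
    0 ≤ (ℓ : ℤ) + wt b
  | 0, b, _ => by simp [wt]
  | n + 1, b, h => by
    have h1 := RegExists.nonneg h.1
    have h2 := abs_le.mp (SignType.abs_intCast_le_one (b 0))
    rw [wt_eq_add_tail]
    by_cases h0 : (ℓ : ℤ) + wt (Fin.tail b) = 0
    · rw [h.2 h0, SignType.coe_one]; omega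
    · omega

theorem RegExists.qRadicand_pos {ℓ n : ℕ} {ab : Fin (n + 1) → SignType}
    (h : RegExists ℓ (n + 1) ab) : 0 < qRadicand (ab 0) (ℓ + wt (Fin.tail ab)) := by
  have h1 := RegExists.nonneg h.1
  have h2 := h.2
  generalize (ℓ : ℤ) + wt (Fin.tail ab) = L at *
  rcases eq_or_lt_of_le h1 with h0 | h0
  · rw [h2 h0.symm, ← h0]; decide
  · generalize ab 0 = c
    rcases c <;> simp only [qRadicand] <;> positivity

theorem SpinExists.radicand_nonneg {ℓ n : ℕ} {σ : Fin (n + 1) → SignType} (h : SpinExists ℓ σ) :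
    0 ≤ ((ℓ : ℤ) - (σ 0 : ℤ) * wt (Fin.tail σ)) * ((ℓ : ℤ) + (σ 0 : ℤ) * wt (Fin.tail σ) + 1) := by
  have h1 := abs_le.mp h
  rw [wt_eq_add_tail] at h1
  generalize wt (Fin.tail σ) = s at *
  generalize σ 0 = c at *
  rcases c
  · simp only [SignType.zero_eq_zero, SignType.coe_zero] at *
    exact mul_nonneg (by omega) (by omega)
  · simp only [SignType.neg_eq_neg_one, SignType.coe_neg_one] at *
    exact mul_nonneg (by omega) (by omega)
  · simp only [SignType.pos_eq_one, SignType.coe_one] at *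
    exact mul_nonneg (by omega) (by omega)

theorem regExists_of_le {ℓ : ℕ} : ∀ {n : ℕ}, n ≤ ℓ → ∀ b : Fin n → SignType, RegExists ℓ n b
  | 0, _, _ => trivial
  | n + 1, h, b => by
    refine ⟨regExists_of_le (by omega) _, fun h0 => ?_⟩
    have := abs_le.mp (abs_wt_le (Fin.tail b))
    omega

theorem spinExists_of_le {ℓ n : ℕ} (h : n ≤ ℓ) (σ : Fin n → SignType) : SpinExists ℓ σ :=
  (abs_wt_le σ).trans (by exact_mod_cast h)

/-! ## The coefficients `Q` as eigenvectors -/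

theorem Qcoef_spinSupported (ℓ n : ℕ) (b : Fin n → SignType) :
    SpinSupported ℓ 0 fun τ => Qcoef ℓ n τ b := by
  intro τ h
  rw [add_zero] at h
  cases n with
  | zero => simp [wt] at h; omega
  | succ n =>
    simp only [Qcoef]
    rw [if_neg]
    rintro ⟨h1, -⟩
    exact absurd h (not_lt.mpr h1)

theorem Qcoef_eq_zero_of_not_regExists {ℓ n : ℕ} (τ : Fin n → SignType) {b : Fin n → SignType}
    (h : ¬RegExists ℓ n b) : Qcoef ℓ n τ b = 0 := by
  cases n with
  | zero => exact absurd trivial h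
  | succ n =>
    simp only [Qcoef]
    rw [if_neg (fun h' => h h'.2)]

/-- The coefficient of `e_0 ⊗ q` in the recursion for `Q`. -/
noncomputable def radialCoef (a : SignType) (L : ℤ) : ℝ :=
  (match a with
    | .neg => (L : ℝ)
    | .zero => 0
    | .pos => (L : ℝ) + 1) / √(qRadicand a L : ℝ)

/-- The coefficient of `e_σ ⊗ R` in the recursion for `Q`. -/
noncomputable def tangentCoef (a σ : SignType) (L : ℤ) : ℝ :=
  (match a with
    | .neg => -1
    | .zero => ((σ : ℤ) : ℝ)
    | .pos => 1) / √(qRadicand a L : ℝ)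

/-- The recursion without its case distinction on the spin index: where `στ` does not exist, the
right-hand side vanishes too, by the support properties of the ladder operators. -/
theorem Qcoef_cons {ℓ n : ℕ} (σ a : SignType) (τ b : Fin n → SignType)
    (h : RegExists ℓ (n + 1) (Fin.cons a b)) :
    Qcoef ℓ (n + 1) (Fin.cons σ τ) (Fin.cons a b) =
      radialCoef a (ℓ + wt b) * ((if σ = 0 then 1 else 0) * Qcoef ℓ n τ b) +
        tangentCoef a σ (ℓ + wt b) * ladder ℓ σ 0 (fun ρ => Qcoef ℓ n ρ b) τ := by
  have hq := Qcoef_spinSupported ℓ n b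
  have key : qNumerator a σ (ℓ + wt b) (Qcoef ℓ n τ b) (Rcoef ℓ (Qcoef ℓ n) σ τ b) /
      √(qRadicand a (ℓ + wt b) : ℝ) =
      radialCoef a (ℓ + wt b) * ((if σ = 0 then 1 else 0) * Qcoef ℓ n τ b) +
        tangentCoef a σ (ℓ + wt b) * ladder ℓ σ 0 (fun ρ => Qcoef ℓ n ρ b) τ := by
    rw [← Rcoef_eq_ladder]
    rcases a <;> simp only [qNumerator, radialCoef, tangentCoef] <;> ring
  simp only [Qcoef, Fin.cons_zero, Fin.tail_cons]
  by_cases hs : SpinExists ℓ (Fin.cons σ τ : Fin (n + 1) → SignType)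
  · rw [if_pos ⟨hs, h⟩, key]
  · rw [if_neg (fun h' => hs h'.1)]
    rw [SpinExists, wt_cons, not_le] at hs
    rcases σ
    · simp only [SignType.zero_eq_zero, SignType.coe_zero, zero_add] at hs ⊢
      rw [show Qcoef ℓ n τ b = 0 from hq τ (by rwa [add_zero]), ladder_zero_left]; ring
    · simp only [SignType.neg_eq_neg_one, SignType.coe_neg_one] at hs ⊢
      rw [hq.ladder_neg_one τ (by rw [show wt τ + (0 - 1) = -1 + wt τ by ring]; exact hs)]; simp
    · simp only [SignType.pos_eq_one, SignType.coe_one] at hs ⊢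
      rw [hq.ladder_one τ (by rw [show wt τ + (0 + 1) = 1 + wt τ by ring]; exact hs)]; simp

/-- The operator `-L² / 2` on a combination of `e_0 ⊗ f` and the `e_σ ⊗ ladder σ f`, for an
eigenvector `f` of the same operator in the lower rank. -/
theorem ladder_ladder_cons {ℓ n : ℕ} {f : (Fin n → SignType) → ℝ} (hf : SpinSupported ℓ 0 f)
    {M : ℝ} (hM : ∀ τ, ladder ℓ (-1) 1 (ladder ℓ 1 0 f) τ = -M * f τ)
    (α : ℝ) (β : SignType → ℝ) (v : (Fin (n + 1) → SignType) → ℝ)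
    (hv : ∀ c τ, v (Fin.cons c τ) =
      α * ((if c = 0 then 1 else 0) * f τ) + β c * ladder ℓ c 0 f τ)
    (c : SignType) (τ : Fin n → SignType) :
    ladder ℓ (-1) 1 (ladder ℓ 1 0 v) (Fin.cons c τ) =
      (if c = 0 then -(M * (α + β 1 + β (-1)) + α) * f τ else 0) -
        (M * β c + α) * ladder ℓ c 0 f τ := by
  have hv0 : ∀ τ, v (Fin.cons 0 τ) = α * f τ := fun τ => by
    rw [hv, if_pos rfl, ladder_zero_left]; ring
  have hv1 : ∀ τ, v (Fin.cons 1 τ) = β 1 * ladder ℓ 1 0 f τ := fun τ => by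
    rw [hv, if_neg (by decide)]; ring
  have hv2 : ∀ τ, v (Fin.cons (-1) τ) = β (-1) * ladder ℓ (-1) 0 f τ := fun τ => by
    rw [hv, if_neg (by decide)]; ring
  -- The commutator vanishes at weight `0`, so the opposite order has the same eigenvalue.
  have hM' : ∀ τ, ladder ℓ 1 (-1) (ladder ℓ (-1) 0 f) τ = -M * f τ := fun τ => by
    have := ladder_neg_one_one_eq ℓ 0 hf τ
    simp only [zero_add, hM, zero_sub, Int.cast_zero, zero_mul, add_zero] at this
    exact this.symm
  have hs : √2 * (√2)⁻¹ = 1 := mul_inv_cancel₀ (by positivity)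
  set g := ladder ℓ 1 0 v with hg
  have hg1 : ∀ τ, g (Fin.cons 1 τ) = β 1 * ladder ℓ 1 1 (ladder ℓ 1 0 f) τ := fun τ => by
    rw [hg, ladder_cons]
    simp only [hv1, ladder_mul, sum_signType]
    simp
  have hg0 : ∀ τ, g (Fin.cons 0 τ) = (α + β 1) * ladder ℓ 1 0 f τ := fun τ => by
    rw [hg, ladder_cons]
    simp only [hv0, ladder_mul, sum_signType]
    simp [hv1]
    ring
  have hg2 : ∀ τ, g (Fin.cons (-1) τ) = -(M * β (-1) + α) * f τ := fun τ => by
    rw [hg, ladder_cons]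
    simp only [hv2, ladder_mul, sum_signType]
    simp [hv0, hM']
    ring
  -- The commutator at weight `1` contributes the summand `1`.
  have hP : ∀ τ, ladder ℓ (-1) 2 (ladder ℓ 1 1 (ladder ℓ 1 0 f)) τ =
      (1 - M) * ladder ℓ 1 0 f τ := fun τ => by
    have := ladder_neg_one_one_eq ℓ 1 (by simpa using hf.ladder_one) τ
    norm_num at this
    rw [this, show ladder ℓ (-1) 1 (ladder ℓ 1 0 f) = fun ρ => -M * f ρ from funext hM,
      ladder_mul]
    ring
  rw [ladder_cons]
  rcases c
  · simp only [SignType.zero_eq_zero]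
    simp only [hg0, ladder_mul, sum_signType]
    simp [hM, hg2, ladder_zero_left]
    linear_combination (-(M * β (-1) + α) * f τ) * hs
  · simp only [SignType.neg_eq_neg_one]
    simp only [hg2, ladder_mul, sum_signType]
    simp
    ring
  · simp only [SignType.pos_eq_one]
    simp only [hg1, ladder_mul, sum_signType]
    simp [hP, hg0]
    linear_combination (-(α + β 1) * ladder ℓ 1 0 f τ) * hs

/-- With `M = L(L+1)/2`, `ladder_ladder_cons` leaves a small eigenvalue problem for `(α, β_1,
β_{-1})`. Its eigenvectors `(L, -1, -1)`, `(0, 1, -1)`, `(L+1, 1, 1)` are those in the recursion for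
`a = -1, 0, 1`, and their eigenvalues are `-L'(L'+1)/2` with `L' = L + a`. -/
theorem Qcoef_ladder_ladder {ℓ : ℕ} : ∀ {n : ℕ} {b : Fin n → SignType}, RegExists ℓ n b → ∀ τ,
    ladder ℓ (-1) 1 (ladder ℓ 1 0 fun ρ => Qcoef ℓ n ρ b) τ =
      -((((ℓ : ℤ) + wt b : ℤ) : ℝ) * (((ℓ : ℤ) + wt b : ℤ) + 1) / 2) * Qcoef ℓ n τ b
  | 0, b, _, τ => by
    have hk := kNum_one_sq ℓ 0 (by omega) (by omega)
    have hJ : ∀ (σ : SignType) (f : (Fin 0 → SignType) → ℝ), Jop σ f τ = 0 := by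
      intro σ f; simp [Jop, Jten]
    have hn := kNum_neg_one_add ℓ 0
    rw [ladder, ladder]
    simp only [hJ, Qcoef, wt, Finset.univ_eq_empty, Finset.sum_empty] at *
    rw [add_zero]
    rw [hn]
    push_cast at *
    linear_combination -hk
  | n + 1, b, h, τ => by
    have hpos := h.qRadicand_pos
    have hb := h.2
    have hL := h.1.nonneg
    have key := ladder_ladder_cons (Qcoef_spinSupported ℓ n (Fin.tail b))
      (Qcoef_ladder_ladder h.1) (radialCoef (b 0) (ℓ + wt (Fin.tail b)))
      (fun c => tangentCoef (b 0) c (ℓ + wt (Fin.tail b)))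
      (fun ρ => Qcoef ℓ (n + 1) ρ b) (fun c τ => by
        have := Qcoef_cons c (b 0) τ (Fin.tail b) (by rwa [Fin.cons_self_tail])
        rwa [Fin.cons_self_tail] at this) (τ 0) (Fin.tail τ)
    have hQ := Qcoef_cons (τ 0) (b 0) (Fin.tail τ) (Fin.tail b) (by rwa [Fin.cons_self_tail])
    rw [Fin.cons_self_tail, Fin.cons_self_tail] at hQ
    rw [Fin.cons_self_tail] at key
    rw [key, hQ, wt_eq_add_tail b]
    generalize Qcoef ℓ n (Fin.tail τ) (Fin.tail b) = q
    generalize ladder ℓ (τ 0) 0 (fun ρ => Qcoef ℓ n ρ (Fin.tail b)) (Fin.tail τ) = R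
    rw [show (ℓ : ℤ) + ((b 0 : SignType) + wt (Fin.tail b)) = ℓ + wt (Fin.tail b) + (b 0 : ℤ)
      by ring]
    generalize (ℓ : ℤ) + wt (Fin.tail b) = L at *
    generalize τ 0 = c
    generalize b 0 = a at *
    rcases a <;> simp only [radialCoef, tangentCoef, SignType.coe_one, SignType.coe_neg_one,
      SignType.coe_zero, SignType.zero_eq_zero, SignType.pos_eq_one, SignType.neg_eq_neg_one] <;>
    split_ifs with hc <;> push_cast <;> ring

/-! ## Orthonormality of the columns -/

theorem sum_ladder_one_mul {ℓ n : ℕ} (b : Fin n → SignType) {b' : Fin n → SignType}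
    (h' : RegExists ℓ n b') :
    ∑ τ, ladder ℓ 1 0 (fun ρ => Qcoef ℓ n ρ b) τ * ladder ℓ 1 0 (fun ρ => Qcoef ℓ n ρ b') τ =
      ((((ℓ : ℤ) + wt b' : ℤ) : ℝ) * (((ℓ : ℤ) + wt b' : ℤ) + 1) / 2) *
        ∑ τ, Qcoef ℓ n τ b * Qcoef ℓ n τ b' := by
  have := sum_mul_ladder_neg_one ℓ 0 (fun ρ => Qcoef ℓ n ρ b)
    (ladder ℓ 1 0 fun ρ => Qcoef ℓ n ρ b')
  rw [← neg_eq_iff_eq_neg.mpr this, Finset.mul_sum, ← Finset.sum_neg_distrib]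
  refine Finset.sum_congr rfl fun τ _ => ?_
  rw [zero_add, Qcoef_ladder_ladder h']
  ring

theorem sum_ladder_neg_one_mul {ℓ n : ℕ} {b : Fin n → SignType} (b' : Fin n → SignType)
    (h : RegExists ℓ n b) :
    ∑ τ, ladder ℓ (-1) 0 (fun ρ => Qcoef ℓ n ρ b) τ * ladder ℓ (-1) 0 (fun ρ => Qcoef ℓ n ρ b') τ =
      ((((ℓ : ℤ) + wt b : ℤ) : ℝ) * (((ℓ : ℤ) + wt b : ℤ) + 1) / 2) *
        ∑ τ, Qcoef ℓ n τ b * Qcoef ℓ n τ b' := by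
  have := sum_mul_ladder_neg_one ℓ (-1) (ladder ℓ (-1) 0 fun ρ => Qcoef ℓ n ρ b)
    (fun ρ => Qcoef ℓ n ρ b')
  rw [neg_add_cancel] at this
  rw [this, Finset.mul_sum, ← Finset.sum_neg_distrib]
  refine Finset.sum_congr rfl fun τ _ => ?_
  have h2 := ladder_neg_one_one_eq ℓ 0 (Qcoef_spinSupported ℓ n b) τ
  rw [zero_add, Int.cast_zero, zero_mul, add_zero, zero_sub, Qcoef_ladder_ladder h] at h2
  rw [← h2]
  ring

/-- Orthonormality of the three eigenvectors when the tangential directions carry the weight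
`L(L+1)/2`: for example `L² + L(L+1) = L(2L+1)` is the radicand for `a = -1`. -/
theorem radialCoef_mul_add_tangentCoef_mul (L : ℤ) (a a' : SignType)
    (ha : 0 < qRadicand a L) (ha' : 0 < qRadicand a' L) :
    radialCoef a L * radialCoef a' L + (L : ℝ) * (L + 1) / 2 *
      (tangentCoef a 1 L * tangentCoef a' 1 L + tangentCoef a (-1) L * tangentCoef a' (-1) L) =
      if a = a' then 1 else 0 := by
  have h : (0 : ℝ) < qRadicand a L := by exact_mod_cast ha
  have h' : (0 : ℝ) < qRadicand a' L := by exact_mod_cast ha'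
  have hs := Real.mul_self_sqrt h.le
  have h0 : √(qRadicand a L : ℝ) ≠ 0 := (Real.sqrt_pos.mpr h).ne'
  have h0' : √(qRadicand a' L : ℝ) ≠ 0 := (Real.sqrt_pos.mpr h').ne'
  by_cases haa : a = a'
  · subst haa
    rw [if_pos rfl]
    rcases a <;> simp only [radialCoef, tangentCoef, SignType.coe_one, SignType.coe_neg_one] <;>
      (field_simp; rw [pow_two (√_), hs]; simp only [qRadicand]; push_cast; ring)
  · rw [if_neg haa]
    rcases a <;> rcases a' <;> first
      | exact absurd rfl haa
      | (simp only [radialCoef, tangentCoef, SignType.coe_one, SignType.coe_neg_one]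
         field_simp
         push_cast
         ring)

theorem Qcoef_columns_orthonormal {ℓ : ℕ} : ∀ {n : ℕ} {a a' : Fin n → SignType},
    RegExists ℓ n a → RegExists ℓ n a' →
      ∑ σ, Qcoef ℓ n σ a * Qcoef ℓ n σ a' = if a = a' then 1 else 0
  | 0, a, a', _, _ => by
    rw [if_pos (Subsingleton.elim _ _)]
    simp [Qcoef]
  | n + 1, a, a', h, h' => by
    have ih := Qcoef_columns_orthonormal h.1 h'.1
    have hp := sum_ladder_one_mul (Fin.tail a) h'.1
    have hn := sum_ladder_neg_one_mul (Fin.tail a') h.1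
    have hr := h.qRadicand_pos
    have hr' := h'.qRadicand_pos
    have hQ : ∀ {a : Fin (n + 1) → SignType}, RegExists ℓ (n + 1) a → ∀ σ τ, _ :=
      fun {a} h σ τ => Qcoef_cons σ (a 0) τ (Fin.tail a) (by rwa [Fin.cons_self_tail])
    simp only [Fin.cons_self_tail] at hQ
    rw [sum_multiIndex_cons, sum_signType]
    simp only [hQ h, hQ h', ladder_zero_left, if_true, one_mul, mul_zero, add_zero]
    rw [ih] at hp hn
    have h1 : ∀ x y u v : ℝ, ∀ f g : (Fin n → SignType) → ℝ,
        ∑ τ, (x * ((if (1 : SignType) = 0 then 1 else 0) * f τ) + u * ladder ℓ 1 0 f τ) *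
          (y * ((if (1 : SignType) = 0 then 1 else 0) * g τ) + v * ladder ℓ 1 0 g τ) =
        u * v * ∑ τ, ladder ℓ 1 0 f τ * ladder ℓ 1 0 g τ := by
      intro x y u v f g
      rw [Finset.mul_sum]
      refine Finset.sum_congr rfl fun τ _ => ?_
      rw [if_neg (by decide)]; ring
    have h2 : ∀ x y u v : ℝ, ∀ f g : (Fin n → SignType) → ℝ,
        ∑ τ, (x * ((if (-1 : SignType) = 0 then 1 else 0) * f τ) + u * ladder ℓ (-1) 0 f τ) *
          (y * ((if (-1 : SignType) = 0 then 1 else 0) * g τ) + v * ladder ℓ (-1) 0 g τ) =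
        u * v * ∑ τ, ladder ℓ (-1) 0 f τ * ladder ℓ (-1) 0 g τ := by
      intro x y u v f g
      rw [Finset.mul_sum]
      refine Finset.sum_congr rfl fun τ _ => ?_
      rw [if_neg (by decide)]; ring
    have h3 : ∀ x y : ℝ, ∀ f g : (Fin n → SignType) → ℝ,
        ∑ τ, x * f τ * (y * g τ) = x * y * ∑ τ, f τ * g τ := by
      intro x y f g
      rw [Finset.mul_sum]
      exact Finset.sum_congr rfl fun τ _ => by ring
    rw [h1, h2, h3, hp, hn, ih]
    by_cases hb : Fin.tail a = Fin.tail a'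
    · rw [← hb] at hr' ⊢
      have := radialCoef_mul_add_tangentCoef_mul _ _ _ hr hr'
      have haa : a = a' ↔ a 0 = a' 0 := by
        constructor
        · rintro rfl; rfl
        · intro h0
          rw [← Fin.cons_self_tail a, ← Fin.cons_self_tail a', hb, h0]
      simp only [haa]
      rw [← this]
      simp only [if_true]
      ring
    -- For different old columns all three block sums are multiples of their inner product, which is
    -- `0`.
    · rw [if_neg hb, if_neg (fun haa => hb (by rw [haa]))]
      ring

/-! ## Counting multi-indices -/

theorem sum_multiIndex_snoc {M α : Type*} [Fintype α] [AddCommMonoid M] {n : ℕ}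
    (f : (Fin (n + 1) → α) → M) :
    ∑ σ, f σ = ∑ c, ∑ τ : Fin n → α, f (Fin.snoc τ c) := by
  rw [← Fintype.sum_prod_type']
  exact (Fintype.sum_equiv (Fin.snocEquiv fun _ => α) _ _ fun _ => rfl).symm

theorem wt_snoc {n : ℕ} (τ : Fin n → SignType) (c : SignType) :
    wt (Fin.snoc τ c : Fin (n + 1) → SignType) = wt τ + (c : ℤ) := by
  simp [wt, Fin.sum_univ_castSucc]

theorem regExists_cons {ℓ n : ℕ} {a : SignType} {b : Fin n → SignType} :
    RegExists ℓ (n + 1) (Fin.cons a b) ↔ RegExists ℓ n b ∧ ((ℓ : ℤ) + wt b = 0 → a = 1) := Iff.rfl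

/-- The last entry is the first step of the path `ℓ, ℓ + c, …`; the remaining entries form a path
starting at the degree `ℓ' = ℓ + c`. -/
theorem regExists_snoc {ℓ : ℕ} {c : SignType} (hc : ℓ = 0 → c = 1) {ℓ' : ℕ}
    (h : (ℓ' : ℤ) = ℓ + (c : ℤ)) : ∀ {n : ℕ} (b : Fin n → SignType),
    RegExists ℓ (n + 1) (Fin.snoc b c) ↔ RegExists ℓ' n b
  | 0, b => by
    refine iff_of_true ⟨trivial, fun h0 => ?_⟩ trivial
    have : ℓ = 0 := by simpa [wt] using h0
    exact hc this
  | n + 1, b => by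
    rw [← Fin.cons_self_tail b, ← Fin.cons_snoc_eq_snoc_cons, regExists_cons, regExists_cons,
      regExists_snoc hc h, wt_snoc, h, add_comm (wt _), add_assoc]

theorem not_regExists_snoc {c : SignType} (hc : c ≠ 1) : ∀ {n : ℕ} (b : Fin n → SignType),
    ¬RegExists 0 (n + 1) (Fin.snoc b c)
  | 0, b => fun h => hc (h.2 (by simp [wt]))
  | n + 1, b => by
    rw [← Fin.cons_self_tail b, ← Fin.cons_snoc_eq_snoc_cons, regExists_cons]
    exact fun h => not_regExists_snoc hc _ h.1

open Classical in
-- Removing the last entry turns regularity indices of degree `ℓ` into those of degrees `ℓ - 1`,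
-- `ℓ`, `ℓ + 1`, or only of degree `1` when `ℓ = 0`. For spin indices with `t = τ̄` the counts
-- match: for `ℓ ≥ 1` as many `c` satisfy `|t + c| ≤ ℓ` as satisfy `|t| ≤ ℓ + c`, and for `ℓ = 0`
-- some `c`, necessarily unique, has `t + c = 0` exactly if `|t| ≤ 1`.
theorem sum_spinExists_eq_sum_regExists : ∀ (n ℓ : ℕ),
    ∑ σ : Fin n → SignType, (if SpinExists ℓ σ then 1 else 0) =
      ∑ b : Fin n → SignType, if RegExists ℓ n b then 1 else 0
  | 0, ℓ => by simp [SpinExists, RegExists, wt]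
  | n + 1, 0 => by
    have h0 : ∀ τ : Fin n → SignType, ¬RegExists 0 (n + 1) (Fin.snoc τ 0) :=
      not_regExists_snoc (by decide)
    have h2 : ∀ τ : Fin n → SignType, ¬RegExists 0 (n + 1) (Fin.snoc τ (-1)) :=
      not_regExists_snoc (by decide)
    have h1 : ∀ τ : Fin n → SignType, RegExists 0 (n + 1) (Fin.snoc τ 1) ↔ RegExists 1 n τ :=
      regExists_snoc (fun _ => rfl) (by simp)
    rw [sum_multiIndex_snoc, sum_multiIndex_snoc, sum_signType, sum_signType]
    simp only [h0, h1, h2, if_false, Finset.sum_const_zero, zero_add,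
      ← sum_spinExists_eq_sum_regExists n 1, ← Finset.sum_add_distrib]
    refine Finset.sum_congr rfl fun τ _ => ?_
    simp only [SpinExists, wt_snoc, abs_le, SignType.coe_one, SignType.coe_neg_one,
      SignType.coe_zero, Nat.cast_zero, Nat.cast_one]
    split_ifs <;> omega
  | n + 1, ℓ + 1 => by
    have h0 : ∀ τ : Fin n → SignType,
        RegExists (ℓ + 1) (n + 1) (Fin.snoc τ 0) ↔ RegExists (ℓ + 1) n τ :=
      regExists_snoc (by omega) (by simp)
    have h2 : ∀ τ : Fin n → SignType,
        RegExists (ℓ + 1) (n + 1) (Fin.snoc τ (-1)) ↔ RegExists ℓ n τ :=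
      regExists_snoc (by omega) (by simp)
    have h1 : ∀ τ : Fin n → SignType,
        RegExists (ℓ + 1) (n + 1) (Fin.snoc τ 1) ↔ RegExists (ℓ + 2) n τ :=
      regExists_snoc (by omega) (by simp; ring)
    rw [sum_multiIndex_snoc, sum_multiIndex_snoc, sum_signType, sum_signType]
    simp only [h0, h1, h2, ← sum_spinExists_eq_sum_regExists n, ← Finset.sum_add_distrib]
    refine Finset.sum_congr rfl fun τ _ => ?_
    simp only [SpinExists, wt_snoc, abs_le, SignType.coe_one, SignType.coe_neg_one,
      SignType.coe_zero, Nat.cast_add, Nat.cast_one, Nat.cast_ofNat]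
    split_ifs <;> omega

/-! ## Orthonormality of the rows -/

theorem sum_subtype_of_eq_zero {α M : Type*} [Fintype α] [AddCommMonoid M] (p : α → Prop)
    [DecidablePred p] (f : α → M) (h : ∀ x, ¬p x → f x = 0) :
    ∑ x : {x // p x}, f x = ∑ x, f x := by
  rw [← Finset.sum_subtype (Finset.univ.filter p) (by simp) f]
  exact Finset.sum_subset (Finset.subset_univ _) fun x _ hx => h x (by simpa using hx)

theorem Qcoef_eq_zero_of_not_spinExists {ℓ n : ℕ} {τ : Fin n → SignType} (b : Fin n → SignType)
    (h : ¬SpinExists ℓ τ) : Qcoef ℓ n τ b = 0 :=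
  Qcoef_spinSupported ℓ n b τ (by rw [add_zero]; exact not_le.mp h)

theorem Qcoef_rows_orthonormal {ℓ n : ℕ} {σ σ' : Fin n → SignType} (hσ : SpinExists ℓ σ)
    (hσ' : SpinExists ℓ σ') :
    ∑ a, Qcoef ℓ n σ a * Qcoef ℓ n σ' a = if σ = σ' then 1 else 0 := by
  classical
  have hcard : Fintype.card {b : Fin n → SignType // RegExists ℓ n b} =
      Fintype.card {σ : Fin n → SignType // SpinExists ℓ σ} := by
    rw [Fintype.card_subtype, Fintype.card_subtype, Finset.card_filter, Finset.card_filter,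
      sum_spinExists_eq_sum_regExists]
  let U : Matrix {b : Fin n → SignType // RegExists ℓ n b}
      {σ : Fin n → SignType // SpinExists ℓ σ} ℝ := Matrix.of fun b σ => Qcoef ℓ n σ b
  have hU : U * U.transpose = 1 := by
    ext a a'
    rw [Matrix.mul_apply, Matrix.one_apply]
    simp only [U, Matrix.transpose_apply, Matrix.of_apply, Subtype.ext_iff]
    rw [← Qcoef_columns_orthonormal a.2 a'.2]
    exact sum_subtype_of_eq_zero (SpinExists ℓ) (fun σ => Qcoef ℓ n σ a * Qcoef ℓ n σ a')
      fun σ h => by rw [Qcoef_eq_zero_of_not_spinExists _ h, zero_mul]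
  -- Equal cardinalities make `U` square, so its right inverse is a left inverse.
  have hU' := (Matrix.mul_eq_one_comm_of_equiv (Fintype.card_eq.mp hcard).some).mp hU
  have := congrFun (congrFun hU' ⟨σ, hσ⟩) ⟨σ', hσ'⟩
  rw [Matrix.mul_apply, Matrix.one_apply] at this
  simp only [U, Matrix.transpose_apply, Matrix.of_apply, Subtype.mk.injEq] at this
  rw [← this]
  exact (sum_subtype_of_eq_zero (RegExists ℓ n) (fun a => Qcoef ℓ n σ a * Qcoef ℓ n σ' a)
    fun a h => by rw [Qcoef_eq_zero_of_not_regExists _ h, zero_mul]).symm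

/-! ## Regularity classes -/

theorem zero_mem_Reg (j : ℤ) : (fun _ => 0 : ℝ → ℂ) ∈ Reg j :=
  ⟨fun _ => 0, analyticAt_const, by simp⟩

theorem Reg.const_mul {j : ℤ} {f : ℝ → ℂ} (hf : f ∈ Reg j) (x : ℂ) :
    (fun r => x * f r) ∈ Reg j := by
  obtain ⟨F, hF, h⟩ := hf
  refine ⟨fun y => x * F y, analyticAt_const.mul hF, ?_⟩
  filter_upwards [h] with r hr
  rw [hr]; ring

theorem Reg.eventually_hasDerivAt {j : ℤ} {f F : ℝ → ℂ} (hF : AnalyticAt ℝ F 0)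
    (h : ∀ᶠ r in 𝓝[>] (0 : ℝ), f r = (r : ℂ) ^ j * F (r ^ 2)) :
    ∀ᶠ r in 𝓝[>] (0 : ℝ), 0 < r ∧ f r = (r : ℂ) ^ j * F (r ^ 2) ∧
      deriv f r = (j : ℂ) * (r : ℂ) ^ (j - 1) * F (r ^ 2) +
        (r : ℂ) ^ j * (2 * r * deriv F (r ^ 2)) := by
  have hsq : Tendsto (fun r : ℝ => r ^ 2) (𝓝[>] 0) (𝓝 0) := by
    have : Tendsto (fun r : ℝ => r ^ 2) (𝓝 0) (𝓝 (0 ^ 2)) := (continuous_pow 2).tendsto 0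
    rw [zero_pow (by norm_num)] at this
    exact this.mono_left nhdsWithin_le_nhds
  filter_upwards [h, eventually_eventually_nhdsWithin.mpr h, self_mem_nhdsWithin,
    hsq.eventually hF.eventually_analyticAt] with r hr hr' hpos hFr
  refine ⟨hpos, hr, ?_⟩
  have hpos : 0 < r := hpos
  have he : f =ᶠ[𝓝 r] fun x : ℝ => (x : ℂ) ^ j * F (x ^ 2) := by
    rwa [nhdsWithin_eq_nhds.mpr (Ioi_mem_nhds hpos)] at hr'
  rw [he.deriv_eq]
  have h1 : HasDerivAt (fun x : ℝ => (x : ℂ) ^ j) ((j : ℂ) * (r : ℂ) ^ (j - 1)) r :=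
    (hasDerivAt_zpow j (r : ℂ) (Or.inl (by exact_mod_cast hpos.ne'))).comp_ofReal
  have h2 : HasDerivAt (fun x : ℝ => F (x ^ 2)) ((2 * r) • deriv F (r ^ 2)) r := by
    have := hFr.differentiableAt.hasDerivAt
    have h3 : HasDerivAt (fun x : ℝ => x ^ 2) (2 * r) r := by simpa using hasDerivAt_pow 2 r
    exact HasDerivAt.scomp r this h3
  have h3 := (h1.mul h2).deriv
  simp only [Pi.mul_def] at h3
  rw [h3]
  simp

/-- For `f = r^L F(r²)`, the term `L/r` in `D^+` cancels the leading part of `f'` and leaves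
`r^{L+1} · 2F'(r²)`, while `D^-` gives `r^{L-1} ((2L+1) F + 2 r² F')(r²)`. -/
theorem radialD_mem_Reg (L : ℤ) (a : SignType) (ha : a ≠ 0) {f : ℝ → ℂ} (hf : f ∈ Reg L) :
    radialD a L f ∈ Reg (L + (a : ℤ)) := by
  obtain ⟨F, hF, h⟩ := hf
  have h' := Reg.eventually_hasDerivAt hF h
  rcases a
  · exact absurd rfl ha
  · refine ⟨fun x => (2 * L + 1) * F x + 2 * x * deriv F x, ?_, ?_⟩
    · have hx : AnalyticAt ℝ (fun x : ℝ => (x : ℂ)) 0 := Complex.ofRealCLM.analyticAt 0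
      exact (analyticAt_const.mul hF).add ((analyticAt_const.mul hx).mul hF.deriv)
    · filter_upwards [h'] with r ⟨hpos, h1, h2⟩
      have h0 : (r : ℂ) ≠ 0 := by exact_mod_cast hpos.ne'
      simp only [radialD, h1, h2, SignType.neg_eq_neg_one, SignType.coe_neg_one,
        ← sub_eq_add_neg, zpow_sub_one₀ h0]
      push_cast
      field_simp
      ring
  · refine ⟨fun x => 2 * deriv F x, analyticAt_const.mul hF.deriv, ?_⟩
    filter_upwards [h'] with r ⟨hpos, h1, h2⟩
    have h0 : (r : ℂ) ≠ 0 := by exact_mod_cast hpos.ne'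
    simp only [radialD, h1, h2, SignType.pos_eq_one, SignType.coe_one, zpow_sub_one₀ h0,
      zpow_add_one₀ h0]
    field_simp
    ring

theorem gradCoeff_mem_Reg {ℓ n : ℕ} {A : (Fin n → SignType) → ℝ → ℂ}
    {ab : Fin (n + 1) → SignType} (hA : A (Fin.tail ab) ∈ Reg (ℓ + wt (Fin.tail ab))) :
    gradCoeff ℓ A ab ∈ Reg (ℓ + wt (Fin.tail ab) + (ab 0 : ℤ)) := by
  by_cases h0 : ab 0 = 0
  · rw [show gradCoeff ℓ A ab = fun _ => 0 by
      funext r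
      rw [gradCoeff, h0]
      simp only [← SignType.zero_eq_zero, xi]
      simp]
    exact zero_mem_Reg _
  · exact Reg.const_mul (radialD_mem_Reg _ _ h0 hA) _

/-! ## The rotation coefficients -/

open Polynomial in
theorem coeff_linear_pow (x y : ℝ) (n k : ℕ) :
    ((C x * X + C y) ^ n).coeff k = n.choose k * x ^ k * y ^ (n - k) := by
  have h : (C x * X + C y) ^ n =
      ∑ i ∈ Finset.range (n + 1), C (x ^ i * y ^ (n - i) * n.choose i) * X ^ i := by
    rw [add_pow]
    refine Finset.sum_congr rfl fun i _ => ?_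
    simp only [mul_pow, map_mul, map_pow, map_natCast]
    ring
  rw [h, finsetSum_coeff]
  simp only [coeff_C_mul, coeff_X_pow, mul_ite, mul_one, mul_zero]
  rw [Finset.sum_ite_eq]
  split_ifs with hk
  · ring
  · rw [Nat.choose_eq_zero_of_lt (by simpa using hk)]; simp

/-- The polynomial `(c X + s)^a (c - s X)^b` with `c = cos (θ / 2)`, `s = sin (θ / 2)`. -/
noncomputable def rotPoly (a b : ℕ) (θ : ℝ) : Polynomial ℝ :=
  (Polynomial.C (cos (θ / 2)) * Polynomial.X + Polynomial.C (sin (θ / 2))) ^ a *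
    (Polynomial.C (-sin (θ / 2)) * Polynomial.X + Polynomial.C (cos (θ / 2))) ^ b

theorem rotPoly_coeff (a b k : ℕ) (θ : ℝ) :
    (rotPoly a b θ).coeff k = ∑ j ∈ Finset.range (k + 1),
      (a.choose (k - j) * b.choose j : ℝ) * (-1) ^ j *
        (cos (θ / 2) ^ (k - j + (b - j)) * sin (θ / 2) ^ (a - (k - j) + j)) := by
  rw [rotPoly, Polynomial.coeff_mul, Finset.Nat.sum_antidiagonal_eq_sum_range_succ_mk,
    ← Finset.sum_range_reflect]
  refine Finset.sum_congr rfl fun j hj => ?_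
  have hj : j ≤ k := by simpa [Nat.lt_succ_iff] using hj
  rw [coeff_linear_pow, coeff_linear_pow, show k + 1 - 1 - j = k - j by omega, Nat.sub_sub_self hj,
    neg_pow, pow_add, pow_add]
  ring

/-- Coefficientwise derivative of a family of polynomials. -/
def HasCoeffDerivAt (p : ℝ → Polynomial ℝ) (p' : Polynomial ℝ) (θ : ℝ) : Prop :=
  ∀ k, HasDerivAt (fun t => (p t).coeff k) (p'.coeff k) θ

theorem HasCoeffDerivAt.mul {p q : ℝ → Polynomial ℝ} {p' q' : Polynomial ℝ} {θ : ℝ}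
    (hp : HasCoeffDerivAt p p' θ) (hq : HasCoeffDerivAt q q' θ) :
    HasCoeffDerivAt (fun t => p t * q t) (p' * q θ + p θ * q') θ := by
  intro k
  simp only [Polynomial.coeff_mul, Polynomial.coeff_add, ← Finset.sum_add_distrib]
  exact HasDerivAt.fun_sum fun x _ => (hp x.1).mul (hq x.2)

theorem HasCoeffDerivAt.pow {p : ℝ → Polynomial ℝ} {p' : Polynomial ℝ} {θ : ℝ}
    (hp : HasCoeffDerivAt p p' θ) (n : ℕ) :
    HasCoeffDerivAt (fun t => p t ^ n) ((n : Polynomial ℝ) * p θ ^ (n - 1) * p') θ := by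
  induction n with
  | zero =>
    intro k
    simp only [pow_zero, Nat.cast_zero, zero_mul, Polynomial.coeff_zero]
    exact hasDerivAt_const _ _
  | succ n ih =>
    have := ih.mul hp
    simp only [← pow_succ] at this
    convert this using 1
    rcases n with _ | n
    · simp
    · simp only [Nat.add_sub_cancel, Nat.cast_add, Nat.cast_one]
      ring

theorem hasCoeffDerivAt_linear {x y : ℝ → ℝ} {x' y' θ : ℝ} (hx : HasDerivAt x x' θ)
    (hy : HasDerivAt y y' θ) :
    HasCoeffDerivAt (fun t => Polynomial.C (x t) * Polynomial.X + Polynomial.C (y t))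
      (Polynomial.C x' * Polynomial.X + Polynomial.C y') θ := by
  intro k
  simp only [Polynomial.coeff_add, Polynomial.coeff_C_mul, Polynomial.coeff_C,
    Polynomial.coeff_X]
  rcases k with _ | _ | k <;> simp [hx, hy, hasDerivAt_const]

theorem hasDerivAt_cos_half (θ : ℝ) :
    HasDerivAt (fun t => cos (t / 2)) (-sin (θ / 2) / 2) θ := by
  have := (hasDerivAt_id θ).div_const 2 |>.cos
  simpa [div_eq_mul_inv] using this

theorem hasDerivAt_sin_half (θ : ℝ) :
    HasDerivAt (fun t => sin (t / 2)) (cos (θ / 2) / 2) θ := by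
  have := (hasDerivAt_id θ).div_const 2 |>.sin
  simpa [div_eq_mul_inv] using this

/-- Absorbs the truncated exponent `a - 1`, with no separate case `a = 0` in the polynomial
identities. -/
theorem natCast_mul_pow_pred_mul {R : Type*} [CommRing R] (a : ℕ) (u : R) :
    (a : R) * u ^ (a - 1) * u = a * u ^ a := by
  rcases a with _ | a
  · simp
  · rw [Nat.add_sub_cancel, pow_succ, mul_assoc]

open Polynomial in
theorem rotPoly_derivative (a b : ℕ) (θ : ℝ) : derivative (rotPoly a b θ) =
    (a : ℝ[X]) * (C (cos (θ / 2)) * X + C (sin (θ / 2))) ^ (a - 1) * C (cos (θ / 2)) *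
        (C (-sin (θ / 2)) * X + C (cos (θ / 2))) ^ b +
      (C (cos (θ / 2)) * X + C (sin (θ / 2))) ^ a * ((b : ℝ[X]) *
        (C (-sin (θ / 2)) * X + C (cos (θ / 2))) ^ (b - 1) * C (-sin (θ / 2))) := by
  simp [rotPoly, derivative_mul, derivative_pow]

open Polynomial in
/-- The derivative of `rotPoly` in the angle generates the rotation of the variable. -/
theorem rotPoly_hasCoeffDerivAt (a b : ℕ) (θ : ℝ) :
    HasCoeffDerivAt (rotPoly a b) (C (1 / 2) * ((1 + X ^ 2) * derivative (rotPoly a b θ) -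
      ((a : ℝ[X]) + (b : ℝ[X])) * X * rotPoly a b θ)) θ := by
  have hu := (hasCoeffDerivAt_linear (hasDerivAt_cos_half θ) (hasDerivAt_sin_half θ)).pow a
  have hv := (hasCoeffDerivAt_linear (x := fun t => -sin (t / 2)) (hasDerivAt_sin_half θ).neg
    (hasDerivAt_cos_half θ)).pow b
  refine (congrArg (fun q => HasCoeffDerivAt (rotPoly a b) q θ) ?_).mpr (hu.mul hv)
  have e1 : (C (-sin (θ / 2) / 2) : ℝ[X]) = -(C (1 / 2) * C (sin (θ / 2))) := by
    rw [← map_mul, ← map_neg]; congr 1; ring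
  have e2 : (C (cos (θ / 2) / 2) : ℝ[X]) = C (1 / 2) * C (cos (θ / 2)) := by
    rw [← map_mul]; congr 1; ring
  have e3 : (C (-(cos (θ / 2) / 2)) : ℝ[X]) = -(C (1 / 2) * C (cos (θ / 2))) := by
    rw [← map_mul, ← map_neg]; congr 1; ring
  have e4 : (C (-sin (θ / 2)) : ℝ[X]) = -C (sin (θ / 2)) := map_neg _ _
  rw [rotPoly_derivative]
  simp only [rotPoly, e1, e2, e3, e4]
  have hA := natCast_mul_pow_pred_mul a (C (cos (θ / 2)) * X + C (sin (θ / 2)) : ℝ[X])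
  have hB := natCast_mul_pow_pred_mul b (-C (sin (θ / 2)) * X + C (cos (θ / 2)) : ℝ[X])
  generalize (C (1 / 2 : ℝ) : ℝ[X]) = e
  generalize (C (cos (θ / 2)) : ℝ[X]) = c at *
  generalize (C (sin (θ / 2)) : ℝ[X]) = s at *
  generalize (c * X + s) ^ (a - 1) = U at *
  generalize (c * X + s) ^ a = UA at *
  generalize (-s * X + c) ^ (b - 1) = V at *
  generalize (-s * X + c) ^ b = VB at *
  linear_combination e * X * VB * hA + e * X * UA * hB

open Polynomial in
/-- The eigenvalue equation of `rotPoly` for the rotated diagonal generator. -/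
theorem rotPoly_eigen (a b : ℕ) (θ : ℝ) :
    ((a : ℝ[X]) - (b : ℝ[X])) * rotPoly a b θ =
      C (cos θ) * (2 * X * derivative (rotPoly a b θ) - ((a : ℝ[X]) + (b : ℝ[X])) * rotPoly a b θ) +
      C (sin θ) * ((1 - X ^ 2) * derivative (rotPoly a b θ) +
        ((a : ℝ[X]) + (b : ℝ[X])) * X * rotPoly a b θ) := by
  have hcs : (C (cos (θ / 2)) : ℝ[X]) ^ 2 + C (sin (θ / 2)) ^ 2 = 1 := by
    rw [← map_pow, ← map_pow, ← map_add, add_comm, Real.sin_sq_add_cos_sq, map_one]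
  have hc : (C (cos θ) : ℝ[X]) = C (cos (θ / 2)) ^ 2 - C (sin (θ / 2)) ^ 2 := by
    rw [← map_pow, ← map_pow, ← map_sub, ← Real.cos_two_mul']
    congr 2; ring
  have hs : (C (sin θ) : ℝ[X]) = 2 * C (sin (θ / 2)) * C (cos (θ / 2)) := by
    rw [← map_ofNat C 2, ← map_mul, ← map_mul, ← Real.sin_two_mul]
    congr 2; ring
  have e4 : (C (-sin (θ / 2)) : ℝ[X]) = -C (sin (θ / 2)) := map_neg _ _
  rw [hc, hs, rotPoly_derivative]
  simp only [rotPoly, e4]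
  have hA := natCast_mul_pow_pred_mul a (C (cos (θ / 2)) * X + C (sin (θ / 2)) : ℝ[X])
  have hB := natCast_mul_pow_pred_mul b (-C (sin (θ / 2)) * X + C (cos (θ / 2)) : ℝ[X])
  generalize (C (cos (θ / 2)) : ℝ[X]) = c at *
  generalize (C (sin (θ / 2)) : ℝ[X]) = s at *
  generalize (c * X + s) ^ (a - 1) = U at *
  generalize (c * X + s) ^ a = UA at *
  generalize (-s * X + c) ^ (b - 1) = V at *
  generalize (-s * X + c) ^ b = VB at *
  linear_combination -(1 + (c ^ 2 - s ^ 2) - 2 * s * c * X) * VB * hA -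
    (-1 + (c ^ 2 - s ^ 2) - 2 * s * c * X) * UA * hB -
    a * U * VB * (c * X + s) * hcs + b * V * UA * (-s * X + c) * hcs

/-- The coefficients of `rotPoly`, with an integer index. -/
noncomputable def rotCoeff (a b : ℕ) (k : ℤ) (θ : ℝ) : ℝ :=
  if 0 ≤ k then (rotPoly a b θ).coeff k.toNat else 0

theorem rotCoeff_natCast (a b k : ℕ) (θ : ℝ) :
    rotCoeff a b k θ = (rotPoly a b θ).coeff k := by
  simp [rotCoeff]

open Polynomial in
theorem coeff_X_mul_rotPoly (a b k : ℕ) (θ : ℝ) :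
    (X * rotPoly a b θ).coeff k = rotCoeff a b (k - 1) θ := by
  rcases k with _ | k
  · simp [rotCoeff]
  · rw [coeff_X_mul, Nat.cast_succ, add_sub_cancel_right, rotCoeff_natCast]

open Polynomial in
theorem coeff_derivative_rotPoly (a b k : ℕ) (θ : ℝ) :
    (derivative (rotPoly a b θ)).coeff k = (k + 1) * rotCoeff a b (k + 1) θ := by
  have h := rotCoeff_natCast a b (k + 1) θ
  push_cast at h
  rw [coeff_derivative, h, mul_comm]

open Polynomial in
theorem coeff_X_mul_derivative_rotPoly (a b k : ℕ) (θ : ℝ) :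
    (X * derivative (rotPoly a b θ)).coeff k = k * rotCoeff a b k θ := by
  rcases k with _ | k
  · simp
  · rw [coeff_X_mul, coeff_derivative_rotPoly]
    push_cast
    ring

open Polynomial in
theorem coeff_X_sq_mul_derivative_rotPoly (a b k : ℕ) (θ : ℝ) :
    (X ^ 2 * derivative (rotPoly a b θ)).coeff k = (k - 1) * rotCoeff a b (k - 1) θ := by
  rw [pow_two, mul_assoc]
  rcases k with _ | k
  · simp [rotCoeff]
  · rw [coeff_X_mul, coeff_X_mul_derivative_rotPoly]
    push_cast
    simp

open Polynomial in
-- The `θ`-derivative is a difference of the two neighbouring coefficients. Together with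
-- `rotCoeff_eigen`, where both occur with a plus sign, it isolates raising and lowering of the spin
-- weight.
theorem rotCoeff_hasDerivAt (a b k : ℕ) (θ : ℝ) :
    HasDerivAt (rotCoeff a b k) (((k + 1) * rotCoeff a b (k + 1) θ -
      (a + b - k + 1) * rotCoeff a b (k - 1) θ) / 2) θ := by
  have h := rotPoly_hasCoeffDerivAt a b θ k
  have h1 : rotCoeff a b k = fun t => (rotPoly a b t).coeff k := by
    funext t; exact rotCoeff_natCast a b k t
  rw [h1]
  convert h using 1
  have hN : ((a : ℝ[X]) + (b : ℝ[X])) = C ((a : ℝ) + b) := by simp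
  rw [hN, show (1 + X ^ 2) * derivative (rotPoly a b θ) - C ((a : ℝ) + b) * X * rotPoly a b θ =
    derivative (rotPoly a b θ) + X ^ 2 * derivative (rotPoly a b θ) -
      C ((a : ℝ) + b) * (X * rotPoly a b θ) by ring, coeff_C_mul, coeff_sub, coeff_add, coeff_C_mul,
    coeff_derivative_rotPoly, coeff_X_sq_mul_derivative_rotPoly, coeff_X_mul_rotPoly]
  ring

open Polynomial in
theorem rotCoeff_eigen (a b k : ℕ) (θ : ℝ) :
    ((a : ℝ) - b) * rotCoeff a b k θ = cos θ * (2 * k - (a + b)) * rotCoeff a b k θ +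
      sin θ * ((k + 1) * rotCoeff a b (k + 1) θ + (a + b - k + 1) * rotCoeff a b (k - 1) θ) := by
  have h : ((a : ℝ[X]) - (b : ℝ[X])) * rotPoly a b θ = _ := rotPoly_eigen a b θ
  have hN : ((a : ℝ[X]) + (b : ℝ[X])) = C ((a : ℝ) + b) := by simp
  have hD : ((a : ℝ[X]) - (b : ℝ[X])) = C ((a : ℝ) - b) := by simp
  rw [hN, hD, show C (cos θ) * (2 * X * derivative (rotPoly a b θ) -
    C ((a : ℝ) + b) * rotPoly a b θ) +
      C (sin θ) * ((1 - X ^ 2) * derivative (rotPoly a b θ) +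
        C ((a : ℝ) + b) * X * rotPoly a b θ) =
      C (cos θ) * (C 2 * (X * derivative (rotPoly a b θ)) - C ((a : ℝ) + b) * rotPoly a b θ) +
      C (sin θ) * (derivative (rotPoly a b θ) - X ^ 2 * derivative (rotPoly a b θ) +
        C ((a : ℝ) + b) * (X * rotPoly a b θ)) by rw [map_ofNat C 2]; ring] at h
  have h2 := congrArg (fun p => Polynomial.coeff p k) h
  simp only [coeff_C_mul, coeff_add, coeff_sub, coeff_derivative_rotPoly,
    coeff_X_sq_mul_derivative_rotPoly, coeff_X_mul_rotPoly, coeff_X_mul_derivative_rotPoly,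
    ← rotCoeff_natCast] at h2
  rw [h2]
  ring

/-! ## Jacobi polynomials as rotation coefficients -/

/-- The product of the half-angle powers and the Jacobi polynomial in a spin-weighted harmonic. -/
noncomputable def halfAngleJacobi (n p q : ℕ) (θ : ℝ) : ℝ :=
  sin (θ / 2) ^ p * cos (θ / 2) ^ q * jacobiP n p q (cos θ)

theorem halfAngleJacobi_eq_sum (n p q : ℕ) (θ : ℝ) :
    halfAngleJacobi n p q θ = ∑ j ∈ Finset.range (n + 1),
      ((n + p).choose (n - j) * (n + q).choose j : ℝ) * (-1) ^ j *
        (cos (θ / 2) ^ (2 * (n - j) + q) * sin (θ / 2) ^ (2 * j + p)) := by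
  have h : cos θ = 2 * cos (θ / 2) ^ 2 - 1 := by
    rw [← Real.cos_two_mul]; congr 1; ring
  have h1 : (cos θ + 1) / 2 = cos (θ / 2) ^ 2 := by rw [h]; ring
  have h2 : (cos θ - 1) / 2 = -sin (θ / 2) ^ 2 := by rw [h, Real.cos_sq']; ring
  rw [halfAngleJacobi, jacobiP, h1, h2, Finset.mul_sum]
  refine Finset.sum_congr rfl fun j _ => ?_
  rw [neg_pow, pow_add, pow_add, pow_mul, pow_mul]
  ring

/-- The harmonic is the coefficient of `X^(ℓ - s)` in the form with exponents `ℓ + m`, `ℓ - m`, up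
to normalisation. This is the case `s ≥ |m|`, with `n = ℓ - s`; the next three lemmas treat `-s ≥
|m|`, `m ≥ |s|` and `-m ≥ |s|`. -/
theorem rotPoly_coeff_spin_ge (n p q : ℕ) (θ : ℝ) :
    (rotPoly (n + p) (n + q) θ).coeff n = halfAngleJacobi n p q θ := by
  rw [rotPoly_coeff, halfAngleJacobi_eq_sum]
  refine Finset.sum_congr rfl fun j hj => ?_
  have hj : j ≤ n := by simpa [Nat.lt_succ_iff] using hj
  congr 3 <;> omega

theorem rotPoly_coeff_spin_le (n p q : ℕ) (θ : ℝ) :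
    (rotPoly (n + q) (n + p) θ).coeff (n + p + q) = (-1) ^ p * halfAngleJacobi n p q θ := by
  rw [rotPoly_coeff, halfAngleJacobi_eq_sum, show n + p + q + 1 = p + (n + 1 + q) by ring,
    Finset.sum_range_add, Finset.sum_range_add, Finset.mul_sum]
  -- Only the middle `n + 1` indices of the convolution have both binomial coefficients nonzero;
  -- shifting them by `p` produces the sign `(-1)^p`.
  have h1 : ∀ j ∈ Finset.range p, ((n + q).choose (n + p + q - j) * (n + p).choose j : ℝ) *
      (-1) ^ j * (cos (θ / 2) ^ (n + p + q - j + (n + p - j)) *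
        sin (θ / 2) ^ (n + q - (n + p + q - j) + j)) = 0 := by
    intro j hj
    rw [Nat.choose_eq_zero_of_lt (by have := Finset.mem_range.mp hj; omega)]
    simp
  have h2 : ∀ i ∈ Finset.range q, ((n + q).choose (n + p + q - (p + (n + 1 + i))) *
      (n + p).choose (p + (n + 1 + i)) : ℝ) * (-1) ^ (p + (n + 1 + i)) *
        (cos (θ / 2) ^ (n + p + q - (p + (n + 1 + i)) + (n + p - (p + (n + 1 + i)))) *
        sin (θ / 2) ^ (n + q - (n + p + q - (p + (n + 1 + i))) + (p + (n + 1 + i)))) = 0 := by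
    intro i _
    rw [Nat.choose_eq_zero_of_lt (show n + p < p + (n + 1 + i) by omega)]
    simp
  rw [Finset.sum_eq_zero h1, Finset.sum_eq_zero h2, zero_add, add_zero]
  refine Finset.sum_congr rfl fun j hj => ?_
  have hj : j ≤ n := by simpa [Nat.lt_succ_iff] using hj
  rw [show n + p + q - (p + j) = n + q - j by omega, Nat.choose_symm (by omega),
    Nat.choose_symm_of_eq_add (show n + p = p + j + (n - j) by omega), pow_add,
    show n + q - j + (n + p - (p + j)) = 2 * (n - j) + q by omega,
    show n + q - (n + q - j) + (p + j) = 2 * j + p by omega]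
  ring

/-- The two sums have different binomial coefficients, but their ratio does not depend on `j`; the
factorials in front are this ratio. -/
theorem rotPoly_coeff_azimuth_ge (n p q : ℕ) (θ : ℝ) :
    ((n + p + q).factorial * n.factorial : ℝ) * halfAngleJacobi n p q θ =
    ((n + p).factorial * (n + q).factorial : ℝ) * (rotPoly (n + p + q) n θ).coeff (n + q) := by
  rw [rotPoly_coeff, halfAngleJacobi_eq_sum, show n + q + 1 = n + 1 + q by ring,
    Finset.sum_range_add _ (n + 1) q]
  have h1 : ∀ i ∈ Finset.range q, ((n + p + q).choose (n + q - (n + 1 + i)) *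
      n.choose (n + 1 + i) : ℝ) * (-1) ^ (n + 1 + i) *
        (cos (θ / 2) ^ (n + q - (n + 1 + i) + (n - (n + 1 + i))) *
        sin (θ / 2) ^ (n + p + q - (n + q - (n + 1 + i)) + (n + 1 + i))) = 0 := by
    intro i _
    rw [Nat.choose_eq_zero_of_lt (show n < n + 1 + i by omega)]
    simp
  rw [Finset.sum_eq_zero h1, add_zero, Finset.mul_sum, Finset.mul_sum]
  refine Finset.sum_congr rfl fun j hj => ?_
  obtain ⟨i, rfl⟩ := Nat.exists_eq_add_of_le (show j ≤ n by simpa [Nat.lt_succ_iff] using hj)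
  rw [show j + i - j = i by omega, show j + i + q - j = i + q by omega,
    show j + i + p + q - (i + q) + j = 2 * j + p by omega,
    show i + q + i = 2 * i + q by omega,
    show j + i + p = i + (j + p) by omega, show j + i + q = j + (i + q) by omega,
    show i + (j + p) + q = i + q + (j + p) by omega,
    Nat.cast_add_choose, Nat.cast_add_choose, Nat.cast_add_choose, Nat.cast_add_choose]
  have := Nat.factorial_ne_zero
  field_simp

theorem rotPoly_coeff_azimuth_le (n p q : ℕ) (θ : ℝ) :
    ((n + p + q).factorial * n.factorial : ℝ) * halfAngleJacobi n p q θ =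
    (-1) ^ p * ((n + p).factorial * (n + q).factorial : ℝ) *
      (rotPoly n (n + p + q) θ).coeff (n + p) := by
  rw [rotPoly_coeff, halfAngleJacobi_eq_sum, show n + p + 1 = p + (n + 1) by ring,
    Finset.sum_range_add _ p (n + 1)]
  have h1 : ∀ j ∈ Finset.range p, (n.choose (n + p - j) * (n + p + q).choose j : ℝ) *
      (-1) ^ j * (cos (θ / 2) ^ (n + p - j + (n + p + q - j)) *
        sin (θ / 2) ^ (n - (n + p - j) + j)) = 0 := by
    intro j hj
    rw [Nat.choose_eq_zero_of_lt (by have := Finset.mem_range.mp hj; omega)]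
    simp
  rw [Finset.sum_eq_zero h1, zero_add, Finset.mul_sum, Finset.mul_sum]
  refine Finset.sum_congr rfl fun j hj => ?_
  obtain ⟨i, rfl⟩ := Nat.exists_eq_add_of_le (show j ≤ n by simpa [Nat.lt_succ_iff] using hj)
  have hp : ((-1 : ℝ) ^ p) * (-1) ^ p = 1 := by rw [← mul_pow]; simp
  rw [show j + i - j = i by omega, show j + i + p - (p + j) = i by omega,
    show i + (j + i + p + q - (p + j)) = 2 * i + q by omega,
    show j + i - i + (p + j) = 2 * j + p by omega,
    show j + i + p = i + (j + p) by omega, show j + i + q = j + (i + q) by omega,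
    show i + (j + p) + q = p + j + (i + q) by omega,
    Nat.choose_symm_of_eq_add (show j + i = i + j by omega), pow_add (-1 : ℝ),
    Nat.cast_add_choose, Nat.cast_add_choose, Nat.cast_add_choose, Nat.cast_add_choose,
    add_comm p j]
  have := Nat.factorial_ne_zero
  field_simp
  linear_combination -(cos (θ / 2) ^ (2 * i + q) * sin (θ / 2) ^ (2 * j + p)) * hp

/-! ## Ladder relations of the spin-weighted harmonics -/

/-- The product `(ℓ + x)! (ℓ - x)!`, for `|x| ≤ ℓ`. -/
noncomputable def factorialPair (ℓ : ℕ) (x : ℤ) : ℝ :=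
  ((ℓ + x).toNat.factorial : ℝ) * ((ℓ - x).toNat.factorial : ℝ)

theorem factorialPair_pos (ℓ : ℕ) (x : ℤ) : 0 < factorialPair ℓ x := by
  unfold factorialPair; positivity

theorem factorialPair_natAbs (ℓ : ℕ) (x : ℤ) (h : x.natAbs ≤ ℓ) :
    ((ℓ + x.natAbs).factorial : ℝ) * ((ℓ - x.natAbs).factorial : ℝ) = factorialPair ℓ x := by
  rw [factorialPair]
  rcases le_total 0 x with hx | hx
  · rw [show (ℓ + x : ℤ).toNat = ℓ + x.natAbs by omega,
        show (ℓ - x : ℤ).toNat = ℓ - x.natAbs by omega]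
  · rw [show (ℓ + x : ℤ).toNat = ℓ - x.natAbs by omega,
        show (ℓ - x : ℤ).toNat = ℓ + x.natAbs by omega,
      mul_comm]

/-- The part of the harmonic independent of the spin weight. -/
noncomputable def azimuthNorm (ℓ : ℕ) (m : ℤ) : ℝ :=
  (-1) ^ m * (√((2 * ℓ + 1) / 2) / √(factorialPair ℓ m))

/-- The polar part of the spin-weighted harmonic, for `|m|, |s| ≤ ℓ`. -/
noncomputable def polarY (ℓ : ℕ) (m s : ℤ) (θ : ℝ) : ℝ :=
  azimuthNorm ℓ m * (√(factorialPair ℓ s) *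
    rotCoeff (ℓ + m).toNat (ℓ - m).toNat (ℓ - s) θ)

theorem Ynorm_mul_halfAngleJacobi (ℓ : ℕ) (m s : ℤ) (hm : m.natAbs ≤ ℓ) (hs : s.natAbs ≤ ℓ)
    (θ : ℝ) :
    Ynorm ℓ m s * halfAngleJacobi (ℓ - max m.natAbs s.natAbs) (m + s).natAbs (m - s).natAbs θ =
      polarY ℓ m s θ := by
  have hX := factorialPair_pos ℓ m
  have hZ := factorialPair_pos ℓ s
  have hX1 : √(factorialPair ℓ m) ≠ 0 := (Real.sqrt_pos.mpr hX).ne'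
  have hZ1 : √(factorialPair ℓ s) ≠ 0 := (Real.sqrt_pos.mpr hZ).ne'
  have hX2 := Real.sq_sqrt hX.le
  have hZ2 := Real.sq_sqrt hZ.le
  have hN : ∀ X Z : ℝ, 0 < X → 0 < Z → √((2 * ℓ + 1 : ℝ) * X / (2 * Z)) =
      √((2 * ℓ + 1) / 2) * √X / √Z := by
    intro X Z hX hZ
    rw [← Real.sqrt_mul (by positivity), ← Real.sqrt_div (by positivity)]
    congr 1
    field_simp
  have hk : ∀ k : ℕ, (ℓ : ℤ) - s = k → rotCoeff (ℓ + m).toNat (ℓ - m).toNat (ℓ - s) θ =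
      (rotPoly (ℓ + m).toNat (ℓ - m).toNat θ).coeff k := by
    intro k hk
    rw [hk, rotCoeff_natCast]
  set n := ℓ - max m.natAbs s.natAbs with hn
  set p := (m + s).natAbs with hp
  set q := (m - s).natAbs with hq
  rcases le_total m.natAbs s.natAbs with hms | hms
  · have hY : Ynorm ℓ m s = (-1) ^ max m (-s) *
        (√((2 * ℓ + 1) / 2) * √(factorialPair ℓ s) / √(factorialPair ℓ m)) := by
      rw [← hN _ _ hZ hX, ← factorialPair_natAbs ℓ m hm, ← factorialPair_natAbs ℓ s hs, Ynorm,
        max_eq_right hms, min_eq_left hms]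
      push_cast
      simp only [mul_assoc]
    rw [max_eq_right hms] at hn
    rcases le_total 0 s with h0 | h0
    · rw [hY, polarY, azimuthNorm, hk n (by omega), show (ℓ + m : ℤ).toNat = n + p by omega,
        show (ℓ - m : ℤ).toNat = n + q by omega, rotPoly_coeff_spin_ge, max_eq_left (by omega)]
      ring
    -- Here `p = -(m + s)`. The `max(m, -s)` in the sign convention exactly compensates the sign of
    -- the coefficient, leaving the uniform sign `(-1)^m`.
    · have hsign : (-1 : ℝ) ^ (-s) = (-1) ^ m * (-1) ^ p := by
        rw [← zpow_natCast, ← zpow_add₀ (by norm_num)]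
        congr 1
        omega
      rw [hY, polarY, azimuthNorm, hk (n + p + q) (by omega),
        show (ℓ + m : ℤ).toNat = n + q by omega,
        show (ℓ - m : ℤ).toNat = n + p by omega, rotPoly_coeff_spin_le, max_eq_right (by omega),
        hsign]
      ring
  · have hY : Ynorm ℓ m s = (-1) ^ max m (-s) *
        (√((2 * ℓ + 1) / 2) * √(factorialPair ℓ m) / √(factorialPair ℓ s)) := by
      rw [← hN _ _ hX hZ, ← factorialPair_natAbs ℓ m hm, ← factorialPair_natAbs ℓ s hs, Ynorm,
        max_eq_left hms, min_eq_right hms]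
      push_cast
      simp only [mul_assoc]
    rw [max_eq_left hms] at hn
    rcases le_total 0 m with h0 | h0
    · have hJ := rotPoly_coeff_azimuth_ge n p q θ
      have e1 : factorialPair ℓ m = (n + p + q).factorial * n.factorial := by
        rw [factorialPair, show (ℓ + m : ℤ).toNat = n + p + q by omega,
          show (ℓ - m : ℤ).toNat = n by omega]
      have e2 : factorialPair ℓ s = (n + p).factorial * (n + q).factorial := by
        rw [factorialPair, show (ℓ + s : ℤ).toNat = n + p by omega,
          show (ℓ - s : ℤ).toNat = n + q by omega]
      rw [← e1, ← e2, ← hX2, ← hZ2] at hJ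
      rw [hY, polarY, azimuthNorm, hk (n + q) (by omega),
        show (ℓ + m : ℤ).toNat = n + p + q by omega,
        show (ℓ - m : ℤ).toNat = n by omega, max_eq_left (by omega)]
      field_simp
      linear_combination hJ
    · have hJ := rotPoly_coeff_azimuth_le n p q θ
      have e1 : factorialPair ℓ m = (n + p + q).factorial * n.factorial := by
        rw [factorialPair, show (ℓ + m : ℤ).toNat = n by omega,
          show (ℓ - m : ℤ).toNat = n + p + q by omega, mul_comm]
      have e2 : factorialPair ℓ s = (n + p).factorial * (n + q).factorial := by
        rw [factorialPair, show (ℓ + s : ℤ).toNat = n + q by omega,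
          show (ℓ - s : ℤ).toNat = n + p by omega, mul_comm]
      have hsign : (-1 : ℝ) ^ (-s) = (-1) ^ m * (-1) ^ p := by
        rw [← zpow_natCast, ← zpow_add₀ (by norm_num)]
        congr 1
        omega
      have hp1 : ((-1 : ℝ) ^ p) * (-1) ^ p = 1 := by rw [← mul_pow]; simp
      rw [← e1, mul_assoc ((-1) ^ p), ← e2, ← hX2, ← hZ2] at hJ
      rw [hY, polarY, azimuthNorm, hk (n + p) (by omega), show (ℓ + m : ℤ).toNat = n by omega,
        show (ℓ - m : ℤ).toNat = n + p + q by omega, max_eq_right (by omega), hsign]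
      field_simp
      linear_combination (-1) ^ p * hJ + √(factorialPair ℓ s) ^ 2 *
        (rotPoly n (n + p + q) θ).coeff (n + p) * hp1

theorem spinY_eq (ℓ : ℕ) (m s : ℤ) (hm : m.natAbs ≤ ℓ) (hs : s.natAbs ≤ ℓ) (θ φ : ℝ) :
    spinY ℓ m s θ φ = (polarY ℓ m s θ : ℂ) * Complex.exp (Complex.I * m * φ) := by
  rw [spinY, if_pos (max_le hm hs), ← Ynorm_mul_halfAngleJacobi ℓ m s hm hs, halfAngleJacobi]
  congr 2
  ring

theorem spinY_eq_zero_of_lt (ℓ : ℕ) (m s : ℤ) (h : ℓ < m.natAbs ∨ ℓ < s.natAbs) (θ φ : ℝ) :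
    spinY ℓ m s θ φ = 0 := by
  rw [spinY, if_neg]
  rw [max_le_iff, not_and_or]
  omega

theorem factorialPair_succ (ℓ : ℕ) (s : ℤ) (h : -(ℓ : ℤ) ≤ s) (h' : s < ℓ) :
    factorialPair ℓ s * (ℓ + s + 1) = (ℓ - s) * factorialPair ℓ (s + 1) := by
  obtain ⟨a, ha⟩ := Int.eq_ofNat_of_zero_le (show 0 ≤ ℓ + s by omega)
  obtain ⟨b, hb⟩ := Int.eq_ofNat_of_zero_le (show 0 ≤ ℓ - s - 1 by omega)
  have e1 : (ℓ + s : ℝ) = a := by exact_mod_cast congrArg (Int.cast : ℤ → ℝ) ha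
  have e2 : (ℓ - s : ℝ) = b + 1 := by
    have := congrArg (Int.cast : ℤ → ℝ) hb
    push_cast at this
    linarith
  rw [factorialPair, factorialPair, show (ℓ + s : ℤ).toNat = a by omega,
    show (ℓ - s : ℤ).toNat = b + 1 by omega, show (ℓ + (s + 1) : ℤ).toNat = a + 1 by omega,
    show (ℓ - (s + 1) : ℤ).toNat = b by omega, e1, e2, Nat.factorial_succ, Nat.factorial_succ]
  push_cast
  ring

theorem kNum_one_nonpos (ℓ : ℕ) (s : ℤ) : kNum ℓ 1 s ≤ 0 := by
  simp only [kNum, SignType.coe_one, Int.cast_one]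
  rw [neg_one_mul, neg_nonpos]
  exact Real.sqrt_nonneg _

/-- Both sides are nonnegative because `k^+ ≤ 0`, so it suffices to compare squares. The normalising
factorials thereby turn the integer coefficients of the rotation recurrences into wavenumbers. -/
theorem sqrt_factorialPair_mul_up (ℓ : ℕ) (s : ℤ) (h : -(ℓ : ℤ) ≤ s) (h' : s < ℓ) :
    √(factorialPair ℓ s) * (ℓ + s + 1) = -√2 * kNum ℓ 1 s * √(factorialPair ℓ (s + 1)) := by
  have h0 : (0 : ℝ) ≤ ℓ + s + 1 := by exact_mod_cast (show (0 : ℤ) ≤ ℓ + s + 1 by omega)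
  have hk := kNum_one_nonpos ℓ s
  have hk2 := kNum_one_sq ℓ s (by omega) h'.le
  have h1 := Real.sq_sqrt (factorialPair_pos ℓ s).le
  have h2 := Real.sq_sqrt (factorialPair_pos ℓ (s + 1)).le
  have h3 : √2 ^ 2 = 2 := Real.sq_sqrt (by norm_num)
  have hn : 0 ≤ -√2 * kNum ℓ 1 s := by
    rw [neg_mul, ← mul_neg]; exact mul_nonneg (Real.sqrt_nonneg _) (neg_nonneg.mpr hk)
  refine (sq_eq_sq₀ (mul_nonneg (Real.sqrt_nonneg _) h0)
    (mul_nonneg hn (Real.sqrt_nonneg _))).mp ?_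
  rw [mul_pow, mul_pow, mul_pow, neg_sq, h1, h2, h3, hk2]
  linear_combination (ℓ + s + 1 : ℝ) * factorialPair_succ ℓ s h h'

theorem sqrt_factorialPair_mul_down (ℓ : ℕ) (s : ℤ) (h : -(ℓ : ℤ) ≤ s) (h' : s < ℓ) :
    √(factorialPair ℓ (s + 1)) * (ℓ - s) = -√2 * kNum ℓ 1 s * √(factorialPair ℓ s) := by
  have h0 : (0 : ℝ) ≤ ℓ - s := by exact_mod_cast (show (0 : ℤ) ≤ ℓ - s by omega)
  have hk := kNum_one_nonpos ℓ s
  have hk2 := kNum_one_sq ℓ s (by omega) h'.le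
  have h1 := Real.sq_sqrt (factorialPair_pos ℓ s).le
  have h2 := Real.sq_sqrt (factorialPair_pos ℓ (s + 1)).le
  have h3 : √2 ^ 2 = 2 := Real.sq_sqrt (by norm_num)
  have hn : 0 ≤ -√2 * kNum ℓ 1 s := by
    rw [neg_mul, ← mul_neg]; exact mul_nonneg (Real.sqrt_nonneg _) (neg_nonneg.mpr hk)
  refine (sq_eq_sq₀ (mul_nonneg (Real.sqrt_nonneg _) h0)
    (mul_nonneg hn (Real.sqrt_nonneg _))).mp ?_
  rw [mul_pow, mul_pow, mul_pow, neg_sq, h1, h2, h3, hk2]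
  linear_combination -(ℓ - s : ℝ) * factorialPair_succ ℓ s h h'

/-- The derivative and eigenvalue recurrences of the rotation coefficients, renormalised. The second
identity expresses the `φ`-derivative, so sum and difference yield the spin raising and lowering
operators. -/
theorem polarY_hasDerivAt (ℓ : ℕ) (m s : ℤ) (hm : m.natAbs ≤ ℓ) (hs : s.natAbs ≤ ℓ) {θ : ℝ}
    (hθ : sin θ ≠ 0) :
    HasDerivAt (polarY ℓ m s)
      (√2 / 2 * (kNum ℓ 1 s * polarY ℓ m (s + 1) θ + kNum ℓ (-1) s * polarY ℓ m (s - 1) θ)) θ ∧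
    m / sin θ * polarY ℓ m s θ = -(s * (cos θ / sin θ)) * polarY ℓ m s θ -
      √2 / 2 * (kNum ℓ 1 s * polarY ℓ m (s + 1) θ - kNum ℓ (-1) s * polarY ℓ m (s - 1) θ) := by
  obtain ⟨k, hk⟩ := Int.eq_ofNat_of_zero_le (show 0 ≤ ℓ - s by omega)
  obtain ⟨a, ha⟩ := Int.eq_ofNat_of_zero_le (show 0 ≤ ℓ + m by omega)
  obtain ⟨b, hb⟩ := Int.eq_ofNat_of_zero_le (show 0 ≤ ℓ - m by omega)
  have hk' : (k : ℝ) = ℓ - s := by exact_mod_cast (congrArg (Int.cast : ℤ → ℝ) hk).symm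
  have hab : (a + b : ℝ) = 2 * ℓ := by
    have : (a + b : ℤ) = 2 * ℓ := by omega
    exact_mod_cast this
  have hab' : (a - b : ℝ) = 2 * m := by
    have : (a - b : ℤ) = 2 * m := by omega
    exact_mod_cast this
  have hder := rotCoeff_hasDerivAt a b k θ
  have heig := rotCoeff_eigen a b k θ
  rw [hab, hk', ← hk] at hder heig
  rw [hab'] at heig
  have hup : √(factorialPair ℓ s) * (ℓ + s + 1) * rotCoeff a b (ℓ - s - 1) θ =
      -√2 * kNum ℓ 1 s * (√(factorialPair ℓ (s + 1)) * rotCoeff a b (ℓ - s - 1) θ) := by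
    by_cases h : s < ℓ
    · rw [sqrt_factorialPair_mul_up ℓ s (by omega) h]; ring
    · have : rotCoeff a b (ℓ - s - 1) θ = 0 := by
        rw [rotCoeff, if_neg (by omega)]
      rw [this]; ring
  have hdown : √(factorialPair ℓ s) * (ℓ - s + 1) * rotCoeff a b (ℓ - s + 1) θ =
      √2 * kNum ℓ (-1) s * (√(factorialPair ℓ (s - 1)) * rotCoeff a b (ℓ - s + 1) θ) := by
    by_cases h : -(ℓ : ℤ) < s
    · have := sqrt_factorialPair_mul_down ℓ (s - 1) (by omega) (by omega)
      rw [sub_add_cancel] at this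
      push_cast at this
      rw [kNum_neg_one, show (ℓ - s + 1 : ℝ) = ℓ - (s - 1) by ring, this]
      ring
    · have h1 : kNum ℓ (-1) s = 0 := by
        rw [kNum_neg_one, show s - 1 = -ℓ - 1 by omega, kNum_one_neg_self_sub_one, neg_zero]
      -- At `s = -ℓ` the index is `2ℓ + 1`, above the degree bound `a + b = 2ℓ`.
      have h2 : rotCoeff a b (ℓ - s + 1) θ = 0 := by
        rw [show (ℓ : ℤ) - s + 1 = ((2 * ℓ + 1 : ℕ) : ℤ) by omega, rotCoeff_natCast]
        refine Polynomial.coeff_eq_zero_of_natDegree_lt (lt_of_le_of_lt ?_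
          (show a + b < 2 * ℓ + 1 by omega))
        refine Polynomial.natDegree_mul_le.trans (add_le_add ?_ ?_) <;>
        · refine Polynomial.natDegree_pow_le.trans ?_
          refine (Nat.mul_le_mul_left _ Polynomial.natDegree_linear_le).trans (by simp)
      rw [h1, h2]; ring
  have e0 : ∀ x t, polarY ℓ m x t = azimuthNorm ℓ m * (√(factorialPair ℓ x) *
      rotCoeff a b (ℓ - x) t) := by
    intro x t
    rw [polarY, show (ℓ + m : ℤ).toNat = a by omega, show (ℓ - m : ℤ).toNat = b by omega]
  have e1 : (ℓ : ℤ) - (s + 1) = ℓ - s - 1 := by ring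
  have e2 : (ℓ : ℤ) - (s - 1) = ℓ - s + 1 := by ring
  constructor
  · have h := (hder.const_mul (√(factorialPair ℓ s))).const_mul (azimuthNorm ℓ m)
    rw [show polarY ℓ m s = fun t => azimuthNorm ℓ m * (√(factorialPair ℓ s) *
      rotCoeff a b (ℓ - s) t) from funext (e0 s)]
    refine h.congr_deriv ?_
    rw [e0, e0, e1, e2]
    linear_combination azimuthNorm ℓ m / 2 * hdown - azimuthNorm ℓ m / 2 * hup
  · rw [e0, e0, e0, e1, e2]
    field_simp
    linear_combination azimuthNorm ℓ m * (√(factorialPair ℓ s)) * heig +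
      azimuthNorm ℓ m * sin θ * hup + azimuthNorm ℓ m * sin θ * hdown

/-! ## Derivatives in the spin frame -/

/-- The differential in the coordinates `(r, θ, φ)` of a function with radial derivative `d 0` and
with derivatives `d (±1) = (∂_θ ± (i / sin θ) ∂_φ) / √2`. -/
noncomputable def spinForm (θ : ℝ) (d : SignType → ℂ) : ℝ × ℝ × ℝ →L[ℝ] ℂ :=
  (ContinuousLinearMap.fst ℝ ℝ (ℝ × ℝ)).smulRight (d 0) +
    ((ContinuousLinearMap.fst ℝ ℝ ℝ).comp (ContinuousLinearMap.snd ℝ ℝ (ℝ × ℝ))).smulRight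
      ((d 1 + d (-1)) / (√2 : ℝ)) +
    ((ContinuousLinearMap.snd ℝ ℝ ℝ).comp (ContinuousLinearMap.snd ℝ ℝ (ℝ × ℝ))).smulRight
      (-Complex.I * sin θ * (d 1 - d (-1)) / (√2 : ℝ))

theorem spinForm_apply (θ : ℝ) (d : SignType → ℂ) (v : ℝ × ℝ × ℝ) :
    spinForm θ d v = v.1 * d 0 + v.2.1 * ((d 1 + d (-1)) / (√2 : ℝ)) +
      v.2.2 * (-Complex.I * sin θ * (d 1 - d (-1)) / (√2 : ℝ)) := by
  simp [spinForm]

/-- `f` is differentiable at `p`, with derivatives `d` in the spin frame. -/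
def HasSpinDeriv (f : ℝ × ℝ × ℝ → ℂ) (d : SignType → ℂ) (p : ℝ × ℝ × ℝ) : Prop :=
  HasFDerivAt f (spinForm p.2.1 d) p

theorem HasSpinDeriv.congr {f : ℝ × ℝ × ℝ → ℂ} {d d' : SignType → ℂ} {p : ℝ × ℝ × ℝ}
    (h : HasSpinDeriv f d p) (hd : ∀ σ, d' σ = d σ) : HasSpinDeriv f d' p := by
  rwa [funext hd]

theorem HasSpinDeriv.mul {f g : ℝ × ℝ × ℝ → ℂ} {d e : SignType → ℂ} {p : ℝ × ℝ × ℝ}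
    (hf : HasSpinDeriv f d p) (hg : HasSpinDeriv g e p) :
    HasSpinDeriv (fun x => f x * g x) (fun σ => d σ * g p + f p * e σ) p := by
  refine (HasFDerivAt.mul hf hg).congr_fderiv ?_
  ext <;> simp [spinForm_apply] <;> ring

theorem HasSpinDeriv.add {f g : ℝ × ℝ × ℝ → ℂ} {d e : SignType → ℂ} {p : ℝ × ℝ × ℝ}
    (hf : HasSpinDeriv f d p) (hg : HasSpinDeriv g e p) :
    HasSpinDeriv (fun x => f x + g x) (fun σ => d σ + e σ) p := by
  refine (HasFDerivAt.add hf hg).congr_fderiv ?_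
  ext <;> simp [spinForm_apply] <;> ring

theorem HasSpinDeriv.const_mul {f : ℝ × ℝ × ℝ → ℂ} {d : SignType → ℂ} {p : ℝ × ℝ × ℝ}
    (hf : HasSpinDeriv f d p) (c : ℂ) :
    HasSpinDeriv (fun x => c * f x) (fun σ => c * d σ) p := by
  refine (HasFDerivAt.const_mul hf c).congr_fderiv ?_
  ext <;> simp [spinForm_apply] <;> ring

theorem hasSpinDeriv_const (c : ℂ) (p : ℝ × ℝ × ℝ) : HasSpinDeriv (fun _ => c) (fun _ => 0) p := by
  refine (hasFDerivAt_const c p).congr_fderiv ?_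
  ext <;> simp [spinForm_apply]

theorem HasSpinDeriv.sum {ι : Type*} (s : Finset ι) {f : ι → ℝ × ℝ × ℝ → ℂ}
    {d : ι → SignType → ℂ} {p : ℝ × ℝ × ℝ} (h : ∀ i ∈ s, HasSpinDeriv (f i) (d i) p) :
    HasSpinDeriv (fun x => ∑ i ∈ s, f i x) (fun σ => ∑ i ∈ s, d i σ) p := by
  classical
  induction s using Finset.induction_on with
  | empty => simpa using hasSpinDeriv_const 0 p
  | insert a s ha ih =>
    simp only [Finset.sum_insert ha]
    exact (h a (Finset.mem_insert_self a s)).add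
      (ih fun i hi => h i (Finset.mem_insert_of_mem hi))

theorem hasSpinDeriv_radial {A : ℝ → ℂ} {A' : ℂ} {p : ℝ × ℝ × ℝ} (h : HasDerivAt A A' p.1) :
    HasSpinDeriv (fun x => A x.1) (fun σ => if σ = 0 then A' else 0) p := by
  have := h.hasFDerivAt.comp p (hasFDerivAt_fst (𝕜 := ℝ) (E := ℝ) (F := ℝ × ℝ))
  refine this.congr_fderiv ?_
  ext <;> simp [spinForm_apply]

theorem hasSpinDeriv_polar {g : ℝ → ℂ} {g' : ℂ} {p : ℝ × ℝ × ℝ} (h : HasDerivAt g g' p.2.1) :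
    HasSpinDeriv (fun x => g x.2.1) (fun σ => (((σ : ℤ) : ℂ)) ^ 2 * g' / (√2 : ℝ)) p := by
  have := h.hasFDerivAt.comp p
    ((hasFDerivAt_fst (𝕜 := ℝ) (E := ℝ) (F := ℝ)).comp p hasFDerivAt_snd)
  refine this.congr_fderiv ?_
  have h2 : ((√2 : ℝ) : ℂ) ^ 2 = 2 := by norm_cast; exact Real.sq_sqrt (by norm_num)
  have h0 : ((√2 : ℝ) : ℂ) ≠ 0 := by norm_num
  ext <;> simp [spinForm_apply]
  field_simp
  rw [h2]; ring

theorem hasSpinDeriv_azimuth {g : ℝ → ℂ} {g' : ℂ} {p : ℝ × ℝ × ℝ} (hp : sin p.2.1 ≠ 0)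
    (h : HasDerivAt g g' p.2.2) :
    HasSpinDeriv (fun x => g x.2.2)
      (fun σ => ((σ : ℤ) : ℂ) * (Complex.I / (sin p.2.1 : ℝ)) * g' / (√2 : ℝ)) p := by
  have := h.hasFDerivAt.comp p
    ((hasFDerivAt_snd (𝕜 := ℝ) (E := ℝ) (F := ℝ)).comp p hasFDerivAt_snd)
  refine this.congr_fderiv ?_
  have h2 : ((√2 : ℝ) : ℂ) ^ 2 = 2 := by norm_cast; exact Real.sq_sqrt (by norm_num)
  have h0 : ((√2 : ℝ) : ℂ) ≠ 0 := by norm_num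
  have h1 : ((sin p.2.1 : ℝ) : ℂ) ≠ 0 := by exact_mod_cast hp
  ext <;> simp [spinForm_apply]
  · ring
  · rw [← Complex.ofReal_sin]
    field_simp
    rw [h2, Complex.I_sq]; ring

theorem hasSpinDeriv_ofReal_mul {g h : ℝ → ℝ} {g' h' : ℝ} {p : ℝ × ℝ × ℝ} (hp : sin p.2.1 ≠ 0)
    (hg : HasDerivAt g g' p.2.1) (hh : HasDerivAt h h' p.2.2) :
    HasSpinDeriv (fun x => ((g x.2.1 * h x.2.2 : ℝ) : ℂ)) (fun σ =>
      (((σ : ℤ) : ℂ) ^ 2 * (g' * h p.2.2) +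
        ((σ : ℤ) : ℂ) * (Complex.I / (sin p.2.1 : ℝ)) * (g p.2.1 * h')) / (√2 : ℝ)) p := by
  have := (hasSpinDeriv_polar hg.ofReal_comp).mul (hasSpinDeriv_azimuth hp hh.ofReal_comp)
  simp only [Complex.ofReal_mul]
  exact this.congr fun σ => by ring

theorem hasSpinDeriv_eR {p : ℝ × ℝ × ℝ} (hp : sin p.2.1 ≠ 0) (i : Fin 3) :
    HasSpinDeriv (fun x => (eR x.2.1 x.2.2 i : ℂ)) (fun σ =>
      (((σ : ℤ) : ℂ) ^ 2 * eTheta p.2.1 p.2.2 i +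
        ((σ : ℤ) : ℂ) * Complex.I * ePhi p.2.2 i) / (√2 : ℝ)) p := by
  have h1 : ((sin p.2.1 : ℝ) : ℂ) ≠ 0 := by exact_mod_cast hp
  fin_cases i
  · refine (hasSpinDeriv_ofReal_mul hp (Real.hasDerivAt_sin _) (Real.hasDerivAt_cos _)).congr
      fun σ => ?_
    simp only [eTheta, ePhi, Fin.zero_eta, Matrix.cons_val_zero, Complex.ofReal_mul,
      Complex.ofReal_neg]
    field_simp
  · refine (hasSpinDeriv_ofReal_mul hp (Real.hasDerivAt_sin _) (Real.hasDerivAt_sin _)).congr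
      fun σ => ?_
    simp only [eTheta, ePhi, Fin.mk_one, Matrix.cons_val_one, Matrix.cons_val_zero,
      Complex.ofReal_mul]
    field_simp
  · have := hasSpinDeriv_ofReal_mul hp (Real.hasDerivAt_cos _) (hasDerivAt_const _ (1 : ℝ))
    simp only [mul_one] at this
    refine this.congr fun σ => ?_
    simp [eTheta, ePhi]

theorem hasSpinDeriv_eTheta {p : ℝ × ℝ × ℝ} (hp : sin p.2.1 ≠ 0) (i : Fin 3) :
    HasSpinDeriv (fun x => (eTheta x.2.1 x.2.2 i : ℂ)) (fun σ =>
      (-((σ : ℤ) : ℂ) ^ 2 * eR p.2.1 p.2.2 i +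
        ((σ : ℤ) : ℂ) * Complex.I * ((cos p.2.1 : ℝ) / (sin p.2.1 : ℝ)) * ePhi p.2.2 i) /
          (√2 : ℝ)) p := by
  have h1 : ((sin p.2.1 : ℝ) : ℂ) ≠ 0 := by exact_mod_cast hp
  fin_cases i
  · refine (hasSpinDeriv_ofReal_mul hp (Real.hasDerivAt_cos _) (Real.hasDerivAt_cos _)).congr
      fun σ => ?_
    simp only [eR, ePhi, Fin.zero_eta, Matrix.cons_val_zero, Complex.ofReal_mul,
      Complex.ofReal_neg]
    field_simp
  · refine (hasSpinDeriv_ofReal_mul hp (Real.hasDerivAt_cos _) (Real.hasDerivAt_sin _)).congr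
      fun σ => ?_
    simp only [eR, ePhi, Fin.mk_one, Matrix.cons_val_one, Matrix.cons_val_zero,
      Complex.ofReal_mul, Complex.ofReal_neg]
    field_simp
  · have := hasSpinDeriv_ofReal_mul hp (Real.hasDerivAt_sin _).neg (hasDerivAt_const _ (1 : ℝ))
    simp only [mul_one] at this
    refine this.congr fun σ => ?_
    simp [eR, ePhi]

theorem hasSpinDeriv_ePhi {p : ℝ × ℝ × ℝ} (hp : sin p.2.1 ≠ 0) (i : Fin 3) :
    HasSpinDeriv (fun x => (ePhi x.2.2 i : ℂ)) (fun σ =>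
      -(((σ : ℤ) : ℂ) * Complex.I * (eR p.2.1 p.2.2 i +
        ((cos p.2.1 : ℝ) / (sin p.2.1 : ℝ)) * eTheta p.2.1 p.2.2 i)) / (√2 : ℝ)) p := by
  have h1 : ((sin p.2.1 : ℝ) : ℂ) ≠ 0 := by exact_mod_cast hp
  have hcs : ((sin p.2.1 : ℝ) : ℂ) ^ 2 + ((cos p.2.1 : ℝ) : ℂ) ^ 2 = 1 := by
    exact_mod_cast Real.sin_sq_add_cos_sq p.2.1
  fin_cases i
  · have := hasSpinDeriv_ofReal_mul hp (hasDerivAt_const _ (1 : ℝ)) (Real.hasDerivAt_sin _).neg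
    simp only [one_mul] at this
    refine this.congr fun σ => ?_
    simp only [eR, eTheta, Fin.zero_eta, Matrix.cons_val_zero, Complex.ofReal_mul,
      Complex.ofReal_neg, Complex.ofReal_zero, Complex.ofReal_one]
    field_simp
    rw [hcs]
    ring
  · have := hasSpinDeriv_ofReal_mul hp (hasDerivAt_const _ (1 : ℝ)) (Real.hasDerivAt_cos _)
    simp only [one_mul] at this
    refine this.congr fun σ => ?_
    simp only [eR, eTheta, Fin.mk_one, Matrix.cons_val_one, Matrix.cons_val_zero,
      Complex.ofReal_mul, Complex.ofReal_neg, Complex.ofReal_zero, Complex.ofReal_one]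
    field_simp
    rw [hcs]
    ring
  · refine (hasSpinDeriv_const 0 p).congr fun σ => ?_
    simp only [eR, eTheta, Fin.reduceFinMk, Matrix.cons_val, Complex.ofReal_neg]
    field_simp
    ring

/-- The derivative of a spin basis vector in the spin frame. -/
theorem hasSpinDeriv_spinBasis {p : ℝ × ℝ × ℝ} (hp : sin p.2.1 ≠ 0) (c : SignType) (i : Fin 3) :
    HasSpinDeriv (fun x => spinBasis c x.2.1 x.2.2 i) (fun σ =>
      -((((σ : ℤ) : ℂ) / (√2 : ℝ)) * ((c : ℤ) * ((cos p.2.1 : ℝ) / (sin p.2.1 : ℝ)) *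
        spinBasis c p.2.1 p.2.2 i + ∑ c', (Jmat σ c c' : ℂ) * spinBasis c' p.2.1 p.2.2 i))) p := by
  -- The frame `e_r, e_θ, e_φ` is differentiated first; the complex combinations then diagonalise
  -- the rotation of the tangent plane, which becomes the `c cot θ` term.
  have hR := hasSpinDeriv_eR hp i
  have hT := hasSpinDeriv_eTheta hp i
  have hP := hasSpinDeriv_ePhi hp i
  have h2 : ((√2 : ℝ) : ℂ) ^ 2 = 2 := by norm_cast; exact Real.sq_sqrt (by norm_num)
  have h0 : ((√2 : ℝ) : ℂ) ≠ 0 := by norm_num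
  have b0 : ∀ x : ℝ × ℝ × ℝ, spinBasis 0 x.2.1 x.2.2 i = eR x.2.1 x.2.2 i := fun _ => rfl
  have b1 : ∀ x : ℝ × ℝ × ℝ, spinBasis 1 x.2.1 x.2.2 i =
    ((√2 : ℝ) : ℂ)⁻¹ * (eTheta x.2.1 x.2.2 i + -Complex.I * ePhi x.2.2 i) := fun x => by
      rw [show spinBasis 1 x.2.1 x.2.2 i = ((eTheta x.2.1 x.2.2 i : ℂ) -
        Complex.I * (ePhi x.2.2 i : ℂ)) / (√2 : ℝ) from rfl]; ring
  have b2 : ∀ x : ℝ × ℝ × ℝ, spinBasis (-1) x.2.1 x.2.2 i =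
    ((√2 : ℝ) : ℂ)⁻¹ * (eTheta x.2.1 x.2.2 i + Complex.I * ePhi x.2.2 i) := fun x => by
      rw [show spinBasis (-1) x.2.1 x.2.2 i = ((eTheta x.2.1 x.2.2 i : ℂ) +
        Complex.I * (ePhi x.2.2 i : ℂ)) / (√2 : ℝ) from rfl]; ring
  simp only [sum_signType]
  rcases c
  · simp only [SignType.zero_eq_zero, b0, b1, b2]
    refine hR.congr fun σ => ?_
    rcases σ <;> simp
    all_goals
      field_simp
      try ring
  · simp only [SignType.neg_eq_neg_one, b0, b1, b2]
    refine ((hT.add (hP.const_mul Complex.I)).const_mul ((√2 : ℝ) : ℂ)⁻¹).congr fun σ => ?_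
    rcases σ <;> simp
    all_goals field_simp
    all_goals
      simp only [h2, Complex.I_sq]
      ring
  · simp only [SignType.pos_eq_one, b0, b1, b2]
    refine ((hT.add (hP.const_mul (-Complex.I))).const_mul ((√2 : ℝ) : ℂ)⁻¹).congr fun σ => ?_
    rcases σ <;> simp
    all_goals field_simp
    all_goals
      simp only [h2, Complex.I_sq]
      ring

/-- By the Leibniz rule the `cot θ` terms add up to the weight and the matrices `J_σ` to their
Kronecker sum. -/
theorem hasSpinDeriv_spinTensor {p : ℝ × ℝ × ℝ} (hp : sin p.2.1 ≠ 0) {n : ℕ} (τ : Fin n → SignType)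
    (I : Fin n → Fin 3) :
    HasSpinDeriv (fun x => spinTensor τ x.2.1 x.2.2 I) (fun σ =>
      -((((σ : ℤ) : ℂ) / (√2 : ℝ)) * ((wt τ : ℂ) * ((cos p.2.1 : ℝ) / (sin p.2.1 : ℝ)) *
        spinTensor τ p.2.1 p.2.2 I +
          ∑ τ', (Jten σ n τ' τ : ℂ) * spinTensor τ' p.2.1 p.2.2 I))) p := by
  induction n with
  | zero =>
    simp only [spinTensor, Finset.univ_eq_empty, Finset.prod_empty]
    refine (hasSpinDeriv_const 1 p).congr fun σ => ?_
    simp [wt, Jten]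
  | succ n ih =>
    have hs : ∀ (τ : Fin (n + 1) → SignType) (θ φ : ℝ), spinTensor τ θ φ I =
        spinBasis (τ 0) θ φ (I 0) * spinTensor (Fin.tail τ) θ φ (Fin.tail I) :=
      fun τ θ φ => by simp [spinTensor, Fin.prod_univ_succ, Fin.tail]
    simp only [hs]
    refine ((hasSpinDeriv_spinBasis hp (τ 0) (I 0)).mul (ih (Fin.tail τ) (Fin.tail I))).congr
      fun σ => ?_
    have hJ : ∑ τ', (Jten σ (n + 1) τ' τ : ℂ) * (spinBasis (τ' 0) p.2.1 p.2.2 (I 0) *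
          spinTensor (Fin.tail τ') p.2.1 p.2.2 (Fin.tail I)) =
        (∑ c', (Jmat σ (τ 0) c' : ℂ) * spinBasis c' p.2.1 p.2.2 (I 0)) *
          spinTensor (Fin.tail τ) p.2.1 p.2.2 (Fin.tail I) +
        spinBasis (τ 0) p.2.1 p.2.2 (I 0) *
          ∑ τ', (Jten σ n τ' (Fin.tail τ) : ℂ) * spinTensor τ' p.2.1 p.2.2 (Fin.tail I) := by
      have hc : ∀ c ρ, Jten σ (n + 1) (Fin.cons c ρ) τ = Jmat σ (τ 0) c *
          (1 : Matrix (Fin n → SignType) (Fin n → SignType) ℝ) ρ (Fin.tail τ) +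
          (1 : Matrix SignType SignType ℝ) c (τ 0) * Jten σ n ρ (Fin.tail τ) := fun c ρ => by
        conv_lhs => rw [← Fin.cons_self_tail τ]
        exact Jten_cons σ n c (τ 0) ρ (Fin.tail τ)
      rw [sum_multiIndex_cons]
      simp only [hc, Fin.cons_zero, Fin.tail_cons, Complex.ofReal_add, Complex.ofReal_mul, add_mul,
        Finset.sum_add_distrib]
      congr 1
      · rw [Finset.sum_mul]
        refine Finset.sum_congr rfl fun c _ => ?_
        rw [Finset.sum_eq_single (Fin.tail τ)]
        · simp [mul_assoc]
        · intro ρ _ hρ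
          rw [Matrix.one_apply_ne hρ]; simp
        · simp
      · rw [Finset.sum_eq_single (τ 0)]
        · rw [Finset.mul_sum]
          refine Finset.sum_congr rfl fun ρ _ => ?_
          rw [Matrix.one_apply_eq]
          simp; ring
        · intro c _ hc
          refine Finset.sum_eq_zero fun ρ _ => ?_
          rw [Matrix.one_apply_ne hc]; simp
        · simp
    rw [hJ, wt_eq_add_tail, Int.cast_add]
    ring

/-- The wavenumber vanishes where `s + σ` leaves the range `[-ℓ, ℓ]`, so reading the missing
harmonic as `0` is harmless. -/
theorem hasSpinDeriv_spinY {p : ℝ × ℝ × ℝ} (hp : sin p.2.1 ≠ 0) (ℓ : ℕ) (m s : ℤ)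
    (hs : s.natAbs ≤ ℓ) :
    HasSpinDeriv (fun x => spinY ℓ m s x.2.1 x.2.2) (fun σ =>
      (kNum ℓ σ s : ℂ) * spinY ℓ m (s + (σ : ℤ)) p.2.1 p.2.2 +
        ((σ : ℤ) : ℂ) / (√2 : ℝ) * ((s : ℂ) * ((cos p.2.1 : ℝ) / (sin p.2.1 : ℝ)) *
          spinY ℓ m s p.2.1 p.2.2)) p := by
  by_cases hm : m.natAbs ≤ ℓ
  swap
  · simp only [spinY_eq_zero_of_lt ℓ m _ (Or.inl (not_le.mp hm))]
    exact (hasSpinDeriv_const 0 p).congr fun σ => by simp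
  obtain ⟨h1, h2⟩ := polarY_hasDerivAt ℓ m s hm hs hp
  have he : HasDerivAt (fun t : ℝ => Complex.exp (Complex.I * m * t))
      (Complex.exp (Complex.I * m * p.2.2) * (Complex.I * m * 1)) p.2.2 :=
    ((Complex.ofRealCLM.hasDerivAt (x := p.2.2)).const_mul (Complex.I * m)).cexp
  have h := (hasSpinDeriv_polar h1.ofReal_comp).mul (hasSpinDeriv_azimuth hp he)
  have hinv : ((√2 : ℝ) : ℂ) * ((√2 : ℝ) : ℂ)⁻¹ = 1 := mul_inv_cancel₀ (by norm_num)
  have hk1 : (kNum ℓ 1 s : ℂ) * spinY ℓ m (s + 1) p.2.1 p.2.2 =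
      kNum ℓ 1 s * (polarY ℓ m (s + 1) p.2.1 * Complex.exp (Complex.I * m * p.2.2)) := by
    by_cases h : (s + 1).natAbs ≤ ℓ
    · rw [spinY_eq ℓ m _ hm h]
    · rw [show s = ℓ by omega, kNum_one_self]; simp
  have hk2 : (kNum ℓ (-1) s : ℂ) * spinY ℓ m (s - 1) p.2.1 p.2.2 =
      kNum ℓ (-1) s * (polarY ℓ m (s - 1) p.2.1 * Complex.exp (Complex.I * m * p.2.2)) := by
    by_cases h : (s - 1).natAbs ≤ ℓ
    · rw [spinY_eq ℓ m _ hm h]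
    · rw [kNum_neg_one, show s - 1 = -ℓ - 1 by omega, kNum_one_neg_self_sub_one]; simp
  have h2' := congrArg (Complex.ofReal) h2
  push_cast at h2'
  simp only [← Complex.ofReal_sin, ← Complex.ofReal_cos] at h2'
  simp only [spinY_eq ℓ m s hm hs]
  refine h.congr fun σ => ?_
  rcases σ
  · simp [SignType.zero_eq_zero, kNum_zero]
  · simp only [SignType.neg_eq_neg_one, SignType.coe_neg_one, ← sub_eq_add_neg, hk2]
    generalize Complex.exp (Complex.I * m * p.2.2) = E at *
    simp only [Complex.ofReal_mul, Complex.ofReal_add, Complex.ofReal_div, Complex.ofReal_ofNat]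
    push_cast [-Complex.ofReal_sin, -Complex.ofReal_cos]
    linear_combination -(E / (√2 : ℝ)) * h2' -
      (kNum ℓ (-1) s * polarY ℓ m (s - 1) p.2.1 * E) * hinv +
      (m / (sin p.2.1 : ℝ) * polarY ℓ m s p.2.1 * E / (√2 : ℝ)) * Complex.I_sq
  · simp only [SignType.pos_eq_one, SignType.coe_one, hk1]
    generalize Complex.exp (Complex.I * m * p.2.2) = E at *
    simp only [Complex.ofReal_mul, Complex.ofReal_add, Complex.ofReal_div, Complex.ofReal_ofNat]
    push_cast [-Complex.ofReal_sin, -Complex.ofReal_cos]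
    linear_combination (E / (√2 : ℝ)) * h2' -
      (kNum ℓ 1 s * polarY ℓ m (s + 1) p.2.1 * E) * hinv -
      (m / (sin p.2.1 : ℝ) * polarY ℓ m s p.2.1 * E / (√2 : ℝ)) * Complex.I_sq

/-! ## The gradient of a single term -/

/-- The angular tensor field `∑_τ f(τ) Y^{τ̄ + w}_{ℓ,m} e(τ)`. -/
noncomputable def angularField (ℓ : ℕ) (m w : ℤ) {n : ℕ} (f : (Fin n → SignType) → ℝ)
    (I : Fin n → Fin 3) (x : ℝ × ℝ × ℝ) : ℂ :=
  ∑ τ, (f τ : ℂ) * spinY ℓ m (wt τ + w) x.2.1 x.2.2 * spinTensor τ x.2.1 x.2.2 I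

/-- The `cot θ` terms of harmonic and basis tensor cancel. In the remaining frame term the selection
rule rewrites `Y^{τ̄}` as `Y^{τ̄' + σ}`, so that exchanging the sums collects `-ladder σ f`. -/
theorem hasSpinDeriv_angularField {p : ℝ × ℝ × ℝ} (hp : sin p.2.1 ≠ 0) (ℓ : ℕ) (m : ℤ) {n : ℕ}
    {f : (Fin n → SignType) → ℝ} (hf : SpinSupported ℓ 0 f) (I : Fin n → Fin 3) :
    HasSpinDeriv (angularField ℓ m 0 f I)
      (fun σ => -angularField ℓ m (σ : ℤ) (ladder ℓ σ 0 f) I p) p := by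
  let d : (Fin n → SignType) → SignType → ℂ := fun τ σ =>
    (f τ : ℂ) * ((kNum ℓ σ (wt τ) : ℂ) * spinY ℓ m (wt τ + (σ : ℤ)) p.2.1 p.2.2 *
      spinTensor τ p.2.1 p.2.2 I) - ((σ : ℤ) : ℂ) / (√2 : ℝ) *
      ∑ τ', (Jten σ n τ' τ : ℂ) * f τ * spinY ℓ m (wt τ' + (σ : ℤ)) p.2.1 p.2.2 *
        spinTensor τ' p.2.1 p.2.2 I
  have h : ∀ τ, HasSpinDeriv (fun x => (f τ : ℂ) * spinY ℓ m (wt τ + 0) x.2.1 x.2.2 *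
      spinTensor τ x.2.1 x.2.2 I) (d τ) p := by
    intro τ
    by_cases hτ : (wt τ).natAbs ≤ ℓ
    · have h := ((hasSpinDeriv_spinY hp ℓ m (wt τ) hτ).const_mul (f τ)).mul
        (hasSpinDeriv_spinTensor hp τ I)
      rw [add_zero]
      refine h.congr fun σ => ?_
      have hJ : ∑ τ', (Jten σ n τ' τ : ℂ) * f τ * spinY ℓ m (wt τ' + (σ : ℤ)) p.2.1 p.2.2 *
          spinTensor τ' p.2.1 p.2.2 I = f τ * spinY ℓ m (wt τ) p.2.1 p.2.2 *
          ∑ τ', (Jten σ n τ' τ : ℂ) * spinTensor τ' p.2.1 p.2.2 I := by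
        rw [Finset.mul_sum]
        refine Finset.sum_congr rfl fun τ' _ => ?_
        by_cases hw : wt τ = wt τ' + (σ : ℤ)
        · rw [← hw]; ring
        · rw [Jten_eq_zero_of_wt_ne σ n τ' τ hw]; simp
      simp only [d, hJ]
      ring
    · have h0 : f τ = 0 := hf τ (by rw [add_zero, Int.abs_eq_natAbs]; omega)
      simp only [h0, Complex.ofReal_zero, zero_mul]
      exact (hasSpinDeriv_const 0 p).congr fun σ => by simp [d, h0]
  refine (HasSpinDeriv.sum Finset.univ fun τ _ => h τ).congr fun σ => ?_
  simp only [d, Finset.sum_sub_distrib, ← Finset.mul_sum]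
  rw [Finset.sum_comm, angularField, ← Finset.sum_neg_distrib, Finset.mul_sum,
    ← Finset.sum_sub_distrib]
  refine Finset.sum_congr rfl fun τ _ => ?_
  simp only [ladder, Jop, add_zero, ← Finset.sum_mul, Complex.ofReal_add, Complex.ofReal_mul,
    Complex.ofReal_neg, Complex.ofReal_div, Complex.ofReal_intCast, Complex.ofReal_sum]
  ring

/-- The derivatives in the spin frame of the `(ℓ, m)` term of a tensor field. -/
noncomputable def tensorTermDeriv (ℓ : ℕ) (m : ℤ) {n : ℕ} (A : (Fin n → SignType) → ℝ → ℂ)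
    (p : ℝ × ℝ × ℝ) (I : Fin n → Fin 3) (σ : SignType) : ℂ :=
  ∑ b, ((if σ = 0 then deriv (A b) p.1 else 0) *
      angularField ℓ m 0 (fun τ => Qcoef ℓ n τ b) I p -
    A b p.1 * angularField ℓ m (σ : ℤ) (ladder ℓ σ 0 fun τ => Qcoef ℓ n τ b) I p)

theorem ladder_zero_fun (ℓ : ℕ) (σ : SignType) (w : ℤ) {n : ℕ} (τ : Fin n → SignType) :
    ladder ℓ σ w (fun _ => 0) τ = 0 := by
  simp [ladder, Jop_zero]

theorem hasSpinDeriv_tensorTerm {p : ℝ × ℝ × ℝ} (hp : sin p.2.1 ≠ 0) (ℓ : ℕ) (m : ℤ) {n : ℕ}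
    {A : (Fin n → SignType) → ℝ → ℂ} (hA : ∀ b, RegExists ℓ n b → DifferentiableAt ℝ (A b) p.1)
    (I : Fin n → Fin 3) :
    HasSpinDeriv (fun x => tensorTerm ℓ m A x I) (tensorTermDeriv ℓ m A p I) p := by
  have h0 : (fun x => tensorTerm ℓ m A x I) = fun x => ∑ b, A b x.1 *
      angularField ℓ m 0 (fun τ => Qcoef ℓ n τ b) I x := by
    funext x
    rw [tensorTerm, Finset.sum_comm]
    refine Finset.sum_congr rfl fun b _ => ?_
    rw [angularField, Finset.mul_sum]
    refine Finset.sum_congr rfl fun τ _ => ?_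
    rw [add_zero]
    ring
  rw [h0]
  refine HasSpinDeriv.congr (HasSpinDeriv.sum (d := fun b σ =>
    (if σ = 0 then deriv (A b) p.1 else 0) * angularField ℓ m 0 (fun τ => Qcoef ℓ n τ b) I p -
      A b p.1 * angularField ℓ m (σ : ℤ) (ladder ℓ σ 0 fun τ => Qcoef ℓ n τ b) I p)
    Finset.univ fun b _ => ?_) fun σ => rfl
  by_cases hb : RegExists ℓ n b
  · exact ((hasSpinDeriv_radial (hA b hb).hasDerivAt).mul (hasSpinDeriv_angularField hp ℓ m
      (Qcoef_spinSupported ℓ n b) I)).congr fun σ => by ring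
  -- For non-existing `b` the function `A b` is arbitrary, but its column is zero.
  · have hQ : ∀ τ, Qcoef ℓ n τ b = 0 := fun τ => Qcoef_eq_zero_of_not_regExists τ hb
    simp only [hQ, angularField, ladder_zero_fun, Complex.ofReal_zero, zero_mul,
      Finset.sum_const_zero, mul_zero, sub_zero]
    exact hasSpinDeriv_const 0 p

theorem sqrt_div_div_sqrt_mul {x y : ℝ} (hx : 0 < x) (hy : 0 < y) :
    √(x / y) / √(x * y) = 1 / y := by
  rw [← Real.sqrt_div (by positivity), show x / y / (x * y) = (1 / y) ^ 2 by field_simp,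
    Real.sqrt_sq (by positivity)]

theorem radialCoef_mul_xi_neg {L : ℤ} (hL : 0 < L) :
    radialCoef (-1) L * xi (-1) L = L / (2 * L + 1) ∧
      ∀ c, tangentCoef (-1) c L * xi (-1) L = -1 / (2 * L + 1) := by
  have hL' : (0 : ℝ) < L := by exact_mod_cast hL
  have h := sqrt_div_div_sqrt_mul hL' (show (0 : ℝ) < 2 * L + 1 by positivity)
  have hr : ((qRadicand (-1) L : ℤ) : ℝ) = L * (2 * L + 1) := by
    rw [← SignType.neg_eq_neg_one, qRadicand]; push_cast; ring
  rw [← SignType.neg_eq_neg_one] at *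
  simp only [radialCoef, tangentCoef, xi, hr]
  exact ⟨by linear_combination (L : ℝ) * h, fun _ => by linear_combination -h⟩

theorem radialCoef_mul_xi_pos {L : ℤ} (hL : 0 ≤ L) :
    radialCoef 1 L * xi 1 L = (L + 1) / (2 * L + 1) ∧
      ∀ c, tangentCoef 1 c L * xi 1 L = 1 / (2 * L + 1) := by
  have hL' : (0 : ℝ) ≤ L := by exact_mod_cast hL
  have h := sqrt_div_div_sqrt_mul (show (0 : ℝ) < L + 1 by positivity)
    (show (0 : ℝ) < 2 * L + 1 by positivity)
  have hr : ((qRadicand 1 L : ℤ) : ℝ) = (L + 1) * (2 * L + 1) := by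
    rw [← SignType.pos_eq_one, qRadicand]; push_cast; ring
  rw [← SignType.pos_eq_one] at *
  simp only [radialCoef, tangentCoef, xi, hr]
  exact ⟨by linear_combination (L + 1 : ℝ) * h, fun _ => by linear_combination h⟩

/-- The squared norm is a multiple of `L(L+1)/2 = 0`: a field with constant Cartesian components has
no tangential gradient. This covers `L = 0`, where only `a = +1` is available. -/
theorem ladder_Qcoef_eq_zero {ℓ n : ℕ} {b : Fin n → SignType} (hb : RegExists ℓ n b)
    (hL : (ℓ : ℤ) + wt b = 0) (c : SignType) (τ : Fin n → SignType) :
    ladder ℓ c 0 (fun ρ => Qcoef ℓ n ρ b) τ = 0 := by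
  have h : ∀ c : SignType, ∑ τ, ladder ℓ c 0 (fun ρ => Qcoef ℓ n ρ b) τ *
      ladder ℓ c 0 (fun ρ => Qcoef ℓ n ρ b) τ = 0 := by
    intro c
    rcases c
    · simp [SignType.zero_eq_zero, ladder_zero_left]
    · rw [SignType.neg_eq_neg_one, sum_ladder_neg_one_mul b hb, hL]; simp
    · rw [SignType.pos_eq_one, sum_ladder_one_mul b hb, hL]; simp
  exact mul_self_eq_zero.mp
    ((Finset.sum_eq_zero_iff_of_nonneg fun _ _ => mul_self_nonneg _).mp (h c) τ (Finset.mem_univ _))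

/-- The sum over the new regularity index in the gradient. -/
theorem sum_Qcoef_cons_mul_radialD {ℓ n : ℕ} (c : SignType) (τ b : Fin n → SignType) (f : ℝ → ℂ)
    {r : ℝ} (hr : r ≠ 0) :
    ∑ a, (Qcoef ℓ (n + 1) (Fin.cons c τ) (Fin.cons a b) : ℂ) *
        (xi a (ℓ + wt b) * radialD a (ℓ + wt b) f r) =
      (if c = 0 then deriv f r else 0) * Qcoef ℓ n τ b -
        ladder ℓ c 0 (fun ρ => Qcoef ℓ n ρ b) τ * (f r / r) := by
  have hr' : (r : ℂ) ≠ 0 := by exact_mod_cast hr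
  by_cases hb : RegExists ℓ n b
  swap
  · have hQ : (fun τ => Qcoef ℓ n τ b) = fun _ => 0 :=
      funext fun τ => Qcoef_eq_zero_of_not_regExists τ hb
    have hQ' : ∀ a, Qcoef ℓ (n + 1) (Fin.cons c τ) (Fin.cons a b) = 0 := fun a =>
      Qcoef_eq_zero_of_not_regExists _ fun h => hb (regExists_cons.mp h).1
    rw [hQ, ladder_zero_fun, Qcoef_eq_zero_of_not_regExists τ hb]
    simp [hQ']
  have hL := hb.nonneg
  have hx : xi 0 (ℓ + wt b) = 0 := rfl
  obtain ⟨p1, p2⟩ := radialCoef_mul_xi_pos hL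
  have e1 := Qcoef_cons c 1 τ b (regExists_cons.mpr ⟨hb, fun _ => rfl⟩)
  have hD : ((2 : ℂ) * (((ℓ : ℤ) + wt b : ℤ) : ℂ) + 1) ≠ 0 := by
    exact_mod_cast (show (2 * ((ℓ : ℤ) + wt b) + 1) ≠ 0 by omega)
  have p1' := congrArg Complex.ofReal p1
  have p2' := congrArg Complex.ofReal (p2 c)
  have e1' := congrArg Complex.ofReal e1
  rw [sum_signType, hx]
  have d1 : ∀ L, radialD 1 L f r = deriv f r - (L : ℂ) / r * f r := fun _ => rfl
  have d2 : ∀ L, radialD (-1) L f r = deriv f r + ((L : ℂ) + 1) / r * f r := fun _ => rfl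
  rcases eq_or_lt_of_le hL with h0 | h0
  · have hlad := ladder_Qcoef_eq_zero hb h0.symm c τ
    have hn : Qcoef ℓ (n + 1) (Fin.cons c τ) (Fin.cons (-1) b) = 0 :=
      Qcoef_eq_zero_of_not_regExists _ fun h =>
        absurd ((regExists_cons.mp h).2 h0.symm) (by decide)
    rw [hn, hlad, d1]
    rw [hlad] at e1'
    rw [← h0] at p1' e1' ⊢
    simp only [mul_zero, add_zero, Complex.ofReal_mul] at e1'
    rw [e1']
    norm_num at p1' ⊢
    split_ifs
    · simp only [Complex.ofReal_one]
      linear_combination (Qcoef ℓ n τ b * deriv f r) * p1'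
    · simp
  · obtain ⟨n1, n2⟩ := radialCoef_mul_xi_neg h0
    have e2 := Qcoef_cons c (-1) τ b (regExists_cons.mpr ⟨hb, fun h => absurd h h0.ne'⟩)
    have n1' := congrArg Complex.ofReal n1
    have n2' := congrArg Complex.ofReal (n2 c)
    have e2' := congrArg Complex.ofReal e2
    generalize ladder ℓ c 0 (fun ρ => Qcoef ℓ n ρ b) τ = R at *
    generalize Qcoef ℓ n τ b = q at *
    generalize (ℓ : ℤ) + wt b = L at *
    rw [e1', e2', d1, d2]
    -- With `D^±` short for `D^±_L f`, the identities are `L D^- + (L+1) D^+ = (2L+1) f'` and `D^+ -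
    -- D^- = -(2L+1) f/r`; the products with `ξ` supply the denominators `2L+1`.
    simp only [Complex.ofReal_mul, Complex.ofReal_add, Complex.ofReal_div, Complex.ofReal_neg,
      Complex.ofReal_one, Complex.ofReal_ofNat, Complex.ofReal_intCast, Complex.ofReal_zero] at *
    have hDi := mul_inv_cancel₀ hD
    split_ifs
    · simp only [Complex.ofReal_one]
      linear_combination (q * (deriv f r + (L + 1) / r * f r)) * n1' +
        (R * (deriv f r + (L + 1) / r * f r)) * n2' +
        (q * (deriv f r - L / r * f r)) * p1' + (R * (deriv f r - L / r * f r)) * p2' +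
        (q * deriv f r - R * f r / r) * hDi
    · simp only [Complex.ofReal_zero]
      linear_combination (R * (deriv f r + (L + 1) / r * f r)) * n2' +
        (R * (deriv f r - L / r * f r)) * p2' - R * f r / r * hDi

/-- The `(ℓ, m)` term of the gradient, assembled from the derivatives in the spin frame. -/
theorem sum_spinBasis_mul_tensorTermDeriv (ℓ : ℕ) (m : ℤ) {n : ℕ} (A : (Fin n → SignType) → ℝ → ℂ)
    {p : ℝ × ℝ × ℝ} (hp : p.1 ≠ 0) (K : Fin (n + 1) → Fin 3) :
    ∑ c, spinBasis c p.2.1 p.2.2 (K 0) * (if c = 0 then 1 else (p.1 : ℂ)⁻¹) *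
        tensorTermDeriv ℓ m A p (Fin.tail K) c =
      tensorTerm ℓ m (gradCoeff ℓ A) p K := by
  rw [tensorTerm, sum_multiIndex_cons]
  refine Finset.sum_congr rfl fun c _ => ?_
  have hs : ∀ τ : Fin n → SignType,
      spinTensor (Fin.cons c τ : Fin (n + 1) → SignType) p.2.1 p.2.2 K =
      spinBasis c p.2.1 p.2.2 (K 0) * spinTensor τ p.2.1 p.2.2 (Fin.tail K) := fun τ => by
    simp [spinTensor, Fin.prod_univ_succ, Fin.tail]
  have hinner : ∀ τ : Fin n → SignType, ∑ ab : Fin (n + 1) → SignType,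
      (Qcoef ℓ (n + 1) (Fin.cons c τ) ab : ℂ) * gradCoeff ℓ A ab p.1 *
        spinY ℓ m (wt (Fin.cons c τ : Fin (n + 1) → SignType)) p.2.1 p.2.2 *
        spinTensor (Fin.cons c τ : Fin (n + 1) → SignType) p.2.1 p.2.2 K =
      ∑ b, ((if c = 0 then deriv (A b) p.1 else 0) * Qcoef ℓ n τ b -
        ladder ℓ c 0 (fun ρ => Qcoef ℓ n ρ b) τ * (A b p.1 / p.1)) *
        (spinY ℓ m (wt τ + (c : ℤ)) p.2.1 p.2.2 * (spinBasis c p.2.1 p.2.2 (K 0) *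
          spinTensor τ p.2.1 p.2.2 (Fin.tail K))) := by
    intro τ
    rw [sum_multiIndex_cons, Finset.sum_comm]
    refine Finset.sum_congr rfl fun b _ => ?_
    rw [← sum_Qcoef_cons_mul_radialD c τ b (A b) hp, Finset.sum_mul, hs, wt_cons, add_comm (c : ℤ)]
    refine Finset.sum_congr rfl fun a _ => ?_
    rw [gradCoeff, Fin.cons_zero, Fin.tail_cons]
    ring
  simp only [hinner]
  rw [Finset.sum_comm, tensorTermDeriv, Finset.mul_sum]
  refine Finset.sum_congr rfl fun b _ => ?_
  simp only [angularField, Finset.mul_sum, ← Finset.sum_sub_distrib]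
  refine Finset.sum_congr rfl fun τ _ => ?_
  by_cases hc : c = 0
  · subst hc
    simp only [ladder_zero_left, if_true, SignType.coe_zero, Complex.ofReal_zero]
    ring
  · simp only [if_neg hc]
    ring

/-! ## Spherical coordinates -/

theorem isOpen_sphDomain : IsOpen sphDomain :=
  isOpen_Ioo.prod (isOpen_Ioo.prod isOpen_univ)

theorem sin_pos_of_mem_sphDomain {p : ℝ × ℝ × ℝ} (hp : p ∈ sphDomain) : 0 < sin p.2.1 :=
  Real.sin_pos_of_pos_of_lt_pi hp.2.1.1 hp.2.1.2

/-- The coordinate velocity of the motion along the `i`-th Cartesian axis. -/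
noncomputable def axisVelocity (p : ℝ × ℝ × ℝ) (i : Fin 3) : ℝ × ℝ × ℝ :=
  (eR p.2.1 p.2.2 i, eTheta p.2.1 p.2.2 i / p.1, ePhi p.2.2 i / (p.1 * sin p.2.1))

theorem spherical_frame_complete (θ φ : ℝ) (i j : Fin 3) :
    eR θ φ i * eR θ φ j + eTheta θ φ i * eTheta θ φ j + ePhi φ i * ePhi φ j =
      if i = j then 1 else 0 := by
  have h1 := Real.sin_sq_add_cos_sq θ
  have h2 := Real.sin_sq_add_cos_sq φ
  fin_cases i <;> fin_cases j <;> simp [eR, eTheta, ePhi]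
  · linear_combination cos φ ^ 2 * h1 + h2
  · linear_combination cos φ * sin φ * h1
  · ring
  · linear_combination cos φ * sin φ * h1
  · linear_combination sin φ ^ 2 * h1 + h2
  · ring
  · ring
  · ring
  · linear_combination h1

/-- The gradient in the spin frame of a function with the given derivatives. -/
theorem spinForm_axisVelocity {p : ℝ × ℝ × ℝ} (hs : sin p.2.1 ≠ 0)
    (d : SignType → ℂ) (i : Fin 3) :
    spinForm p.2.1 d (axisVelocity p i) =
      ∑ c, spinBasis c p.2.1 p.2.2 i * (if c = 0 then 1 else (p.1 : ℂ)⁻¹) * d c := by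
  have hs' : ((sin p.2.1 : ℝ) : ℂ) ≠ 0 := by exact_mod_cast hs
  have b0 : spinBasis 0 p.2.1 p.2.2 i = eR p.2.1 p.2.2 i := rfl
  have b1 : spinBasis 1 p.2.1 p.2.2 i =
    (eTheta p.2.1 p.2.2 i - Complex.I * ePhi p.2.2 i) / (√2 : ℝ) := rfl
  have b2 : spinBasis (-1) p.2.1 p.2.2 i =
    (eTheta p.2.1 p.2.2 i + Complex.I * ePhi p.2.2 i) / (√2 : ℝ) := rfl
  have h0 : ∀ x : ℂ, (ePhi p.2.2 i : ℂ) / ((p.1 : ℂ) * (sin p.2.1 : ℝ)) *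
      (-Complex.I * (sin p.2.1 : ℝ) * x) = ePhi p.2.2 i * (p.1 : ℂ)⁻¹ * (-Complex.I * x) := by
    intro x
    rw [div_eq_mul_inv, mul_inv]
    linear_combination (ePhi p.2.2 i * (p.1 : ℂ)⁻¹ * (-Complex.I * x)) * mul_inv_cancel₀ hs'
  rw [spinForm_apply, sum_signType, b0, b1, b2, if_pos rfl, if_neg (by decide), if_neg (by decide)]
  simp only [axisVelocity, Complex.ofReal_div, Complex.ofReal_mul]
  rw [mul_div_assoc (-Complex.I * _), h0]
  ring

theorem contDiff_sphPoint : ContDiff ℝ 1 sphPoint := by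
  rw [contDiff_euclidean]
  intro i
  fin_cases i <;> simp [sphPoint, eR] <;> fun_prop

/-- The position is `r e_r`, so the spin-frame derivative of `e_r` already gives its differential;
completeness of the orthonormal frame then yields the Cartesian unit vector. -/
theorem fderiv_sphPoint_axisVelocity {p : ℝ × ℝ × ℝ} (hr : p.1 ≠ 0) (hs : sin p.2.1 ≠ 0)
    (i : Fin 3) :
    fderiv ℝ sphPoint p (axisVelocity p i) = EuclideanSpace.single i 1 := by
  have hD : HasFDerivAt sphPoint (fderiv ℝ sphPoint p) p :=
    (contDiff_sphPoint.differentiable (by norm_num) p).hasFDerivAt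
  ext j
  have h1 : HasFDerivAt (fun x => ((sphPoint x j : ℝ) : ℂ))
      (Complex.ofRealCLM.comp ((EuclideanSpace.proj j).comp (fderiv ℝ sphPoint p))) p :=
    (Complex.ofRealCLM.hasFDerivAt).comp p
      (((EuclideanSpace.proj (𝕜 := ℝ) j).hasFDerivAt (x := sphPoint p)).comp p hD)
  have h2 := (hasSpinDeriv_radial (p := p) (Complex.ofRealCLM.hasDerivAt (x := p.1))).mul
    (hasSpinDeriv_eR hs j)
  have h3 : (fun x : ℝ × ℝ × ℝ => Complex.ofRealCLM x.1 * (eR x.2.1 x.2.2 j : ℂ)) =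
      fun x => ((sphPoint x j : ℝ) : ℂ) := by
    funext x
    simp [sphPoint]
  rw [h3] at h2
  have h4 := congrArg (fun f : ℝ × ℝ × ℝ →L[ℝ] ℂ => f (axisVelocity p i)) (h1.unique h2)
  have hw : ((√2 : ℝ) : ℂ) ^ 2 = 2 := by norm_cast; exact Real.sq_sqrt (by norm_num)
  have hr' : (p.1 : ℂ) ≠ 0 := by exact_mod_cast hr
  have hs' : ((sin p.2.1 : ℝ) : ℂ) ≠ 0 := by exact_mod_cast hs
  have hw0 : ((√2 : ℝ) : ℂ) ≠ 0 := by norm_num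
  rw [spinForm_apply] at h4
  have h5 := congrArg Complex.ofReal (spherical_frame_complete p.2.1 p.2.2 i j)
  apply Complex.ofReal_injective
  refine Eq.trans h4 (Eq.trans ?_ (h5.trans ?_))
  · simp [axisVelocity, -Complex.ofReal_sin]
    field_simp
    rw [hw]
    linear_combination -2 * (ePhi p.2.2 i : ℂ) * ePhi p.2.2 j * Complex.I_sq
  · simp [eq_comm]

theorem hasStrictFDerivAt_sphPoint {p : ℝ × ℝ × ℝ} (hr : p.1 ≠ 0) (hs : sin p.2.1 ≠ 0) :
    ∃ D : (ℝ × ℝ × ℝ) ≃L[ℝ] EuclideanSpace ℝ (Fin 3),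
      HasStrictFDerivAt sphPoint (D : (ℝ × ℝ × ℝ) →L[ℝ] EuclideanSpace ℝ (Fin 3)) p ∧
      ∀ i, D (axisVelocity p i) = EuclideanSpace.single i 1 := by
  have hsurj : Function.Surjective (fderiv ℝ sphPoint p) := by
    intro y
    refine ⟨∑ i, y i • axisVelocity p i, ?_⟩
    rw [map_sum]
    simp only [map_smul, fderiv_sphPoint_axisVelocity hr hs]
    ext j
    fin_cases j <;> simp [Fin.sum_univ_three]
  -- All Cartesian unit vectors are attained, and source and target both have dimension three.
  have hinj : Function.Injective (fderiv ℝ sphPoint p) :=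
    (LinearMap.injective_iff_surjective_of_finrank_eq_finrank
      (f := (fderiv ℝ sphPoint p : (ℝ × ℝ × ℝ) →ₗ[ℝ] EuclideanSpace ℝ (Fin 3))) (by simp)).mpr hsurj
  refine ⟨ContinuousLinearEquiv.ofBijective (fderiv ℝ sphPoint p) (LinearMap.ker_eq_bot.mpr hinj)
    (LinearMap.range_eq_top.mpr hsurj), ?_, fun i => ?_⟩
  · exact contDiff_sphPoint.contDiffAt.hasStrictFDerivAt (by norm_num)
  · exact fderiv_sphPoint_axisVelocity hr hs i

/-! ## The gradient of the sum -/

/-- Composition with the local inverse of the coordinate map transfers differentiability from the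
coordinates back to the field itself. -/
theorem hasFDerivAt_of_comp_sphPoint {E : Type*} [NormedAddCommGroup E] [NormedSpace ℝ E]
    {T : EuclideanSpace ℝ (Fin 3) → E} {p : ℝ × ℝ × ℝ} (hr : p.1 ≠ 0) (hs : sin p.2.1 ≠ 0)
    {g' : ℝ × ℝ × ℝ →L[ℝ] E} (h : HasFDerivAt (fun x => T (sphPoint x)) g' p) :
    DifferentiableAt ℝ T (sphPoint p) ∧
      ∀ i, fderiv ℝ T (sphPoint p) (EuclideanSpace.single i 1) = g' (axisVelocity p i) := by
  obtain ⟨D, hD, hDi⟩ := hasStrictFDerivAt_sphPoint hr hs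
  have hinv := hD.to_localInverse.hasFDerivAt
  have hp : hD.localInverse sphPoint D p (sphPoint p) = p := hD.localInverse_apply_image
  have hcomp : HasFDerivAt (fun y => T (sphPoint (hD.localInverse sphPoint D p y)))
      (g'.comp (D.symm : EuclideanSpace ℝ (Fin 3) →L[ℝ] ℝ × ℝ × ℝ)) (sphPoint p) :=
    HasFDerivAt.comp (g := fun x => T (sphPoint x)) (sphPoint p) (by rwa [hp]) hinv
  have hT : HasFDerivAt T (g'.comp (D.symm : EuclideanSpace ℝ (Fin 3) →L[ℝ] ℝ × ℝ × ℝ))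
      (sphPoint p) :=
    hcomp.congr_of_eventuallyEq (hD.eventually_right_inverse.mono fun y hy => (congrArg T hy).symm)
  refine ⟨hT.differentiableAt, fun i => ?_⟩
  rw [hT.fderiv, ← hDi i]
  simp

theorem hasFDerivAt_tensorTerm {p : ℝ × ℝ × ℝ} (hp : sin p.2.1 ≠ 0) (ℓ : ℕ) (m : ℤ) {n : ℕ}
    {A : (Fin n → SignType) → ℝ → ℂ} (hA : ∀ b, RegExists ℓ n b → DifferentiableAt ℝ (A b) p.1) :
    HasFDerivAt (tensorTerm ℓ m A)
      (ContinuousLinearMap.pi fun I => spinForm p.2.1 (tensorTermDeriv ℓ m A p I)) p :=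
  hasFDerivAt_pi.mpr fun I => hasSpinDeriv_tensorTerm hp ℓ m hA I

theorem HasSum.clm_apply_const {ι E F : Type*} [NormedAddCommGroup E] [NormedSpace ℝ E]
    [NormedAddCommGroup F] [NormedSpace ℝ F] {f : ι → E →L[ℝ] F} {g : E →L[ℝ] F} (h : HasSum f g)
    (v : E) : HasSum (fun i => f i v) (g v) :=
  h.mapL (ContinuousLinearMap.apply ℝ F v)

theorem HasSumLocallyUniformlyOn.hasFDerivAt {ι E F : Type*} [NormedAddCommGroup E]
    [NormedSpace ℝ E] [NormedAddCommGroup F] [NormedSpace ℝ F] {f : ι → E → F}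
    {f' : ι → E → E →L[ℝ] F} {g : E → F} {g' : E → E →L[ℝ] F} {s : Set E}
    (hf' : HasSumLocallyUniformlyOn f' g' s) (hs : IsOpen s)
    (hf : ∀ i, ∀ x ∈ s, HasFDerivAt (f i) (f' i x) x)
    (hg : ∀ x ∈ s, HasSum (fun i => f i x) (g x)) {x : E} (hx : x ∈ s) :
    HasFDerivAt g (g' x) x := by
  refine hasFDerivAt_of_tendstoLocallyUniformlyOn hs
    (hasSumLocallyUniformlyOn_iff_tendstoLocallyUniformlyOn.mp hf')
    (f := fun t x => ∑ i ∈ t, f i x) (fun t x hx => ?_) (fun x hx => ?_) hx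
  · exact HasFDerivAt.fun_sum fun i _ => hf i x hx
  · simpa [HasSum] using hg x hx

theorem tensorGrad_hasSum {n : ℕ} {A : ℕ → ℤ → (Fin n → SignType) → ℝ → ℂ}
    {T : EuclideanSpace ℝ (Fin 3) → (Fin n → Fin 3) → ℂ}
    (hA : ∀ ℓ m a, RegExists ℓ n a → DifferentiableOn ℝ (A ℓ m a) (Ioo 0 1))
    (hT : ∀ p ∈ sphDomain,
      HasSum (fun i : ℕ × ℤ => tensorTerm i.1 i.2 (A i.1 i.2) p) (T (sphPoint p)))
    (hsum : SummableLocallyUniformlyOn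
      (fun (i : ℕ × ℤ) p => fderiv ℝ (tensorTerm i.1 i.2 (A i.1 i.2)) p) sphDomain)
    {p : ℝ × ℝ × ℝ} (hp : p ∈ sphDomain) :
    DifferentiableAt ℝ T (sphPoint p) ∧
      HasSum (fun i : ℕ × ℤ => tensorTerm i.1 i.2 (gradCoeff i.1 (A i.1 i.2)) p)
        (tensorGrad T (sphPoint p)) := by
  obtain ⟨g', hg'⟩ := hsum
  have hterm : ∀ (i : ℕ × ℤ), ∀ x ∈ sphDomain, HasFDerivAt (tensorTerm i.1 i.2 (A i.1 i.2))
      (ContinuousLinearMap.pi fun I => spinForm x.2.1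
          (tensorTermDeriv i.1 i.2 (A i.1 i.2) x I)) x :=
    fun i x hx => hasFDerivAt_tensorTerm (sin_pos_of_mem_sphDomain hx).ne' i.1 i.2 fun b hb =>
      (hA i.1 i.2 b hb).differentiableAt (isOpen_Ioo.mem_nhds hx.1)
  have hder : HasFDerivAt (fun x => T (sphPoint x)) (g' p) p :=
    hg'.hasFDerivAt isOpen_sphDomain
      (fun i x hx => (hterm i x hx).differentiableAt.hasFDerivAt) hT hp
  have hr : p.1 ≠ 0 := hp.1.1.ne'
  have hs := (sin_pos_of_mem_sphDomain hp).ne'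
  obtain ⟨hd, hgrad⟩ := hasFDerivAt_of_comp_sphPoint hr hs hder
  refine ⟨hd, Pi.hasSum.mpr fun K => ?_⟩
  rw [tensorGrad, hgrad]
  have h0 : HasSum (fun i : ℕ × ℤ => fderiv ℝ (tensorTerm i.1 i.2 (A i.1 i.2)) p) (g' p) :=
    hg'.hasSum hp
  -- Evaluation at a fixed vector is continuous and linear, so the series of differentials gives the
  -- series of each Cartesian derivative, with its unconditional convergence.
  have h1 := h0.clm_apply_const (axisVelocity p (K 0))
  have h3 := Pi.hasSum.mp h1 (Fin.tail K)
  convert h3 using 2 with i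
  symm
  rw [(hterm i p hp).fderiv]
  exact (spinForm_axisVelocity hs _ (K 0)).trans
    (sum_spinBasis_mul_tensorTermDeriv i.1 i.2 (A i.1 i.2) hr K)

/-! ### Assembly of the statements. -/

theorem mainTheorem2 (n : ℕ) :
    -- the recursion is well defined in the step from rank `n` to rank `n + 1`
    (∀ (ℓ : ℕ) (σ a : Fin (n + 1) → SignType), SpinExists ℓ σ → RegExists ℓ (n + 1) a →
      0 ≤ ((ℓ : ℤ) - (σ 0 : ℤ) * wt (Fin.tail σ)) * ((ℓ : ℤ) + (σ 0 : ℤ) * wt (Fin.tail σ) + 1) ∧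
      0 < qRadicand (a 0) (ℓ + wt (Fin.tail a))) ∧
    -- if the degree is at least the rank, all rows and columns exist
    (∀ ℓ : ℕ, n ≤ ℓ → ∀ σ : Fin n → SignType, SpinExists ℓ σ ∧ RegExists ℓ n σ) ∧
    -- orthonormality in both indices
    (∀ (ℓ : ℕ) (σ σ' : Fin n → SignType), SpinExists ℓ σ → SpinExists ℓ σ' →
      ∑ a : Fin n → SignType, Qcoef ℓ n σ a * Qcoef ℓ n σ' a = if σ = σ' then 1 else 0) ∧
    (∀ (ℓ : ℕ) (a a' : Fin n → SignType), RegExists ℓ n a → RegExists ℓ n a' →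
      ∑ σ : Fin n → SignType, Qcoef ℓ n σ a * Qcoef ℓ n σ a' = if a = a' then 1 else 0) ∧
    -- the gradient of a rank-`n` tensor field
    (∀ (A : ℕ → ℤ → (Fin n → SignType) → ℝ → ℂ)
        (T : EuclideanSpace ℝ (Fin 3) → (Fin n → Fin 3) → ℂ),
      (∀ ℓ m a, RegExists ℓ n a → DifferentiableOn ℝ (A ℓ m a) (Ioo 0 1)) →
      (∀ p ∈ sphDomain,
        HasSum (fun i : ℕ × ℤ => tensorTerm i.1 i.2 (A i.1 i.2) p) (T (sphPoint p))) →
      SummableLocallyUniformlyOn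
        (fun (i : ℕ × ℤ) p => fderiv ℝ (tensorTerm i.1 i.2 (A i.1 i.2)) p) sphDomain →
      ∀ p ∈ sphDomain, DifferentiableAt ℝ T (sphPoint p) ∧
        HasSum (fun i : ℕ × ℤ => tensorTerm i.1 i.2 (gradCoeff i.1 (A i.1 i.2)) p)
          (tensorGrad T (sphPoint p))) ∧
    -- the mapping between regularity classes
    (∀ (L : ℤ) (a : SignType), a ≠ 0 →
      ∀ f ∈ Reg L, radialD a L f ∈ Reg (L + (a : ℤ))) ∧
    (∀ (ℓ : ℕ) (A : (Fin n → SignType) → ℝ → ℂ),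
      (∀ b, RegExists ℓ n b → A b ∈ Reg (ℓ + wt b)) →
      ∀ ab : Fin (n + 1) → SignType, RegExists ℓ (n + 1) ab →
        gradCoeff ℓ A ab ∈ Reg (ℓ + wt (Fin.tail ab) + (ab 0 : ℤ))) := by
  refine ⟨fun ℓ σ a hσ ha => ⟨hσ.radicand_nonneg, ha.qRadicand_pos⟩,
    fun ℓ h σ => ⟨spinExists_of_le h σ, regExists_of_le h σ⟩, fun ℓ σ σ' h h' => ?_,
    fun ℓ a a' h h' => ?_, fun A T hA hT hs p hp => tensorGrad_hasSum hA hT hs hp,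
    fun L a ha f hf => radialD_mem_Reg L a ha hf,
    fun ℓ A hA ab hab => gradCoeff_mem_Reg (hA _ hab.1)⟩
  · exact Qcoef_rows_orthonormal h h'
  · exact Qcoef_columns_orthonormal h h'
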